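/- Let $d\ge 1$. A Fano $d$-polyhedron is a convex polytope $P\subset\mathbb R^d$ such that all vertices of $P$ lie in $\mathbb Z^d$, the origin lies in the interior of $P$, every proper face of $P$ is a simplex, and the vertices of every $(d-1)$-dimensional face of $P$ form a $\mathbb Z$-basis of $\mathbb Z^d$. Let $\Sigma(P)$ be the set consisting of the cone $\{0\}$ and of the cones $\sigma(F)$ over the nonempty proper faces $F$ of $P$, where $\sigma(F)$ is the set of all nonnegative real linear combinations of the vertices of $F$ (which are called the generators of $\sigma(F)$; the cone $\{0\}$ has no generators). A set $\{v_1,\dots,v_k\}$ of vertices of $P$ is a primitive collection if it is not contained in any cone of $\Sigma(P)$, while each of its proper subsets is contained in some cone of $\Sigma(P)$. Its primitive relation is $v_1+\dots+v_k=c_1w_1+\dots+c_mw_m$, where $w_1,\dots,w_m$ are the generators of the cone of minimal dimension in $\Sigma(P)$ that contains $v_1+\dots+v_k$ and the $c_i$ are positive integers (the right-hand side is $0$ if the sum is $0$). Two Fano $d$-polyhedra are isomorphic if some element of $\mathrm{GL}(d,\mathbb Z)$ maps one onto the other. Let $f_0(P)$ be the number of vertices of $P$, and let $e_1,\dots,e_4$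 be the standard basis of $\mathbb Z^4$. Let $P$ be a Fano $4$-polyhedron such that for every two-element primitive collection $\{v,v'\}$ of vertices of $P$ the primitive relation is $v+v'=0$. Then: (i) $f_0(P)\le 10$; (ii) if $f_0(P)=10$, then $P$ is isomorphic to the convex hull of $\pm e_1,\ \pm e_2,\ \pm e_3,\ \pm e_4,\ \pm(e_1+e_2+e_3+e_4)$; (iii) if $f_0(P)=9$, then $P$ is isomorphic to the convex hull of $\pm e_1,\ \pm e_2,\ \pm e_3,\ \pm e_4,\ e_1+e_2+e_3+e_4$. -/

import Mathlib

/-- A nonempty proper face of a convex set `P`: the nonempty set, different from `P`, of the points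
of `P` at which some linear functional attains its maximum over `P`. -/
def IsProperFace {d : ℕ} (P F : Set (Fin d → ℝ)) : Prop :=
  IsExposed ℝ P F ∧ F.Nonempty ∧ F ≠ P

/-- A facet, that is, a `(d - 1)`-dimensional face, of a `d`-dimensional polyhedron `P`. -/
def IsFacet {d : ℕ} (P F : Set (Fin d → ℝ)) : Prop :=
  IsProperFace P F ∧ Module.finrank ℝ (vectorSpan ℝ F) + 1 = d

/-- A `d`-dimensional Fano polyhedron in `ℝ^d`. The vertices of `P` are its extreme points. -/
structure IsFanoPolyhedron {d : ℕ} (P : Set (Fin d → ℝ)) : Prop where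
  /-- `P` is a convex polyhedron: the convex hull of finitely many points. -/
  polytope : ∃ s : Finset (Fin d → ℝ), P = convexHull ℝ (s : Set (Fin d → ℝ))
  /-- All vertices are lattice points. -/
  lattice : ∀ v ∈ P.extremePoints ℝ, ∃ z : Fin d → ℤ, v = fun i => (z i : ℝ)
  /-- The origin is an interior point. -/
  zero_mem_interior : (0 : Fin d → ℝ) ∈ interior P
  /-- Every proper face is a simplex. -/
  simplicial : ∀ F, IsProperFace P F → ∃ s : Finset (Fin d → ℝ),
    AffineIndependent ℝ (fun v : s => (v : Fin d → ℝ)) ∧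
      F = convexHull ℝ (s : Set (Fin d → ℝ))
  /-- The vertices of every facet are the rows of an integral matrix of determinant `1` or `-1`. -/
  unimodular : ∀ F, IsFacet P F → ∃ A : Matrix (Fin d) (Fin d) ℤ,
    F.extremePoints ℝ = Set.range (fun (i j : Fin d) => (A i j : ℝ)) ∧
      (A.det = 1 ∨ A.det = -1)

/-- The sets of generators of the cones of the fan of `P`: the empty set (for the cone `{0}`)
and the vertex sets of the nonempty proper faces of `P`. -/
def IsFanGenerators {d : ℕ} (P G : Set (Fin d → ℝ)) : Prop :=
  G = ∅ ∨ ∃ F, IsProperFace P F ∧ G = F.extremePoints ℝ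

/-- The polyhedral fan `Σ(P)`. `PointedCone.hull ℝ G` is the set of all linear combinations of
elements of `G` with nonnegative real coefficients. -/
def polyhedralFan {d : ℕ} (P : Set (Fin d → ℝ)) : Set (PointedCone ℝ (Fin d → ℝ)) :=
  {σ | ∃ G, IsFanGenerators P G ∧ σ = PointedCone.hull ℝ G}

/-- The dimension of a cone is the dimension of its linear span. -/
noncomputable def coneDim {d : ℕ} (σ : PointedCone ℝ (Fin d → ℝ)) : ℕ :=
  Module.finrank ℝ (Submodule.span ℝ (σ : Set (Fin d → ℝ)))

/-- Primitive collections of vertices of `P`. -/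
structure IsPrimitiveCollection {d : ℕ} (P : Set (Fin d → ℝ)) (S : Finset (Fin d → ℝ)) :
    Prop where
  subset_vertices : (S : Set (Fin d → ℝ)) ⊆ P.extremePoints ℝ
  not_in_cone : ¬ ∃ σ ∈ polyhedralFan P, (S : Set (Fin d → ℝ)) ⊆ σ
  proper_in_cone : ∀ T ⊂ S, ∃ σ ∈ polyhedralFan P, (T : Set (Fin d → ℝ)) ⊆ σ

/-- The relation `∑_{v ∈ S} v = ∑_w c_w w` is the primitive relation of the primitive collection
`S`: the sum of `S` is a combination, with positive integral coefficients, of the generators of the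
cone of minimal dimension in `Σ(P)` that contains it. The support of `c` is the set of these
generators; the relation with `c = 0` reads `∑_{v ∈ S} v = 0`. -/
structure IsPrimitiveRelation {d : ℕ} (P : Set (Fin d → ℝ)) (S : Finset (Fin d → ℝ))
    (c : (Fin d → ℝ) →₀ ℕ) : Prop where
  collection : IsPrimitiveCollection P S
  generators : IsFanGenerators P (c.support : Set (Fin d → ℝ))
  minimal : ∀ τ ∈ polyhedralFan P, ∑ v ∈ S, v ∈ τ →
    coneDim (PointedCone.hull ℝ (c.support : Set (Fin d → ℝ))) ≤ coneDim τ
  relation : ∑ v ∈ S, v = ∑ w ∈ c.support, c w • w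

/-- Two polyhedra in `ℝ^d` are isomorphic if some element of `GL(d, ℤ)` maps one onto the other. -/
def IsIsomorphicTo {d : ℕ} (P Q : Set (Fin d → ℝ)) : Prop :=
  ∃ A : Matrix.GeneralLinearGroup (Fin d) ℤ,
    (fun x : Fin d → ℝ =>
      Matrix.mulVec ((A : Matrix (Fin d) (Fin d) ℤ).map (fun z : ℤ => (z : ℝ))) x) '' P = Q

/-- The `i`-th standard basis vector of `ℝ^d`. -/
def stdVec {d : ℕ} (i : Fin d) : Fin d → ℝ := Pi.single i 1

/-! Everything is reduced to the finite set `V` of lattice vertices and to levels. For a facet with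
vertex basis `b`, `level b` is the linear form equal to 1 on the facet; all other vertices have
level at most 0. The hypothesis on two-element primitive collections says that two distinct,
non-opposite vertices always lie on a common facet.

Bound. The vertex sum ν lies in the cone over some facet, so 0 ≤ level ν = 4 + (sum of the negative
levels), and at most 4 - level ν vertices have negative level. A vertex at level 0 has at least two
negative coordinates (`eq_neg_of_nonneg`). If its i-th coordinate is negative, it is the vertex that
replaces `b i` in the adjacent facet (`level_zero_coord`), so different level-zero vertices have
disjoint sets of negative coordinates. There are thus at most two of them, and the total is at most
4 + 2 + 4 = 10.

Ten vertices. All estimates are equalities, so ν = 0 and every facet is extremal in this sense.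
Comparing levels on adjacent facets shows that the vertices at level -1 are the -`b i`; then ν = 0
makes the two level-zero vertices opposite to each other.

Nine vertices. Now level ν ≤ 1, so ν is 0 or a vertex `b i` of the facet. If ν = `b i`, the facets
through `b i` still have all levels at least -1, and the coordinates are determined by integer
arithmetic (`coords_of_sum_eq`). The case ν = 0 is impossible (`sum_ne_zero`): two level-zero
vertices would force a vertex at level -2, which `IsDeep.false` excludes, and a single level-zero
vertex on every facet leaves too few vertices at level -1.

The three properties of `V` used above come from the polar dual: facets are found at its extreme
points, adjacent facets by a ratio test. -/

open Module

/-- The sum of the coordinates of `x` in the basis `b`: the value at `x` of the linear form that is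
`1` on `b`. -/
noncomputable def level {d : ℕ} (b : Basis (Fin d) ℤ (Fin d → ℤ)) (x : Fin d → ℤ) : ℤ := ∑ i, b.repr x i

/-- `b` is the vertex set of a facet of the smooth Fano polytope with vertex set `V`. -/
structure IsFacetBasis {d : ℕ} (V : Finset (Fin d → ℤ)) (b : Basis (Fin d) ℤ (Fin d → ℤ)) :
    Prop where
  mem : ∀ i, b i ∈ V
  level_le : ∀ x ∈ V, level b x ≤ 1
  mem_range : ∀ x ∈ V, level b x = 1 → x ∈ Set.range b

/-- The properties of the vertex set of a smooth Fano polytope, in which any two vertices that are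
not opposite to each other are joined by an edge, that the classification uses. -/
structure IsNeighborlyFano {d : ℕ} (V : Finset (Fin d → ℤ)) : Prop where
  exists_cone : ∀ y, ∃ b, IsFacetBasis V b ∧ ∀ i, 0 ≤ b.repr y i
  exists_neighbor : ∀ b, IsFacetBasis V b → ∀ i, ∃ b', IsFacetBasis V b' ∧
    (∀ j, j ≠ i → b' j = b j) ∧ b' i ≠ b i
  exists_common : ∀ x ∈ V, ∀ y ∈ V, x ≠ y → x + y ≠ 0 → ∃ b, IsFacetBasis V b ∧
    x ∈ Set.range b ∧ y ∈ Set.range b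

/-! ### Levels and coordinates on adjacent facets, in any dimension -/

section General

variable {d : ℕ} {V : Finset (Fin d → ℤ)} {b b' : Basis (Fin d) ℤ (Fin d → ℤ)}

lemma level_add (b : Basis (Fin d) ℤ (Fin d → ℤ)) (x y : Fin d → ℤ) :
    level b (x + y) = level b x + level b y := by
  simp [level, Finset.sum_add_distrib]

lemma level_neg (b : Basis (Fin d) ℤ (Fin d → ℤ)) (x : Fin d → ℤ) :
    level b (-x) = -level b x := by
  simp [level]

lemma level_zero (b : Basis (Fin d) ℤ (Fin d → ℤ)) : level b 0 = 0 := by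
  simp [level]

lemma level_sum {ι : Type*} (b : Basis (Fin d) ℤ (Fin d → ℤ)) (s : Finset ι)
    (f : ι → Fin d → ℤ) : level b (∑ i ∈ s, f i) = ∑ i ∈ s, level b (f i) := by
  simp only [level, map_sum, Finsupp.coe_finsetSum, Finset.sum_apply]
  exact Finset.sum_comm

lemma level_self (b : Basis (Fin d) ℤ (Fin d → ℤ)) (i : Fin d) : level b (b i) = 1 := by
  simp [level, Finsupp.single_apply]

lemma level_eq_sum_repr (b b' : Basis (Fin d) ℤ (Fin d → ℤ)) (x : Fin d → ℤ) :
    level b x = ∑ j, b'.repr x j * level b (b' j) := by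
  conv_lhs => rw [← b'.sum_repr x]
  rw [level_sum]
  refine Finset.sum_congr rfl fun j _ => ?_
  simp only [level, map_smul, Finsupp.smul_apply, smul_eq_mul, Finset.mul_sum]

lemma repr_eq_sum_repr (b b' : Basis (Fin d) ℤ (Fin d → ℤ)) (x : Fin d → ℤ) (k : Fin d) :
    b.repr x k = ∑ j, b'.repr x j * b.repr (b' j) k := by
  conv_lhs => rw [← b'.sum_repr x]
  simp only [map_sum, map_smul, Finsupp.coe_finsetSum, Finset.sum_apply, Finsupp.smul_apply,
    smul_eq_mul]

lemma level_reindex (b : Basis (Fin d) ℤ (Fin d → ℤ)) (σ : Equiv.Perm (Fin d)) (x : Fin d → ℤ) :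
    level (b.reindex σ) x = level b x := by
  simp only [level, Basis.repr_reindex_apply]
  exact Equiv.sum_comp σ.symm fun i => b.repr x i

lemma IsFacetBasis.reindex (hb : IsFacetBasis V b) (σ : Equiv.Perm (Fin d)) :
    IsFacetBasis V (b.reindex σ) := by
  have hl := level_reindex b σ
  refine ⟨fun i => by simpa using hb.mem _, fun x hx => hl x ▸ hb.level_le x hx,
    fun x hx h => ?_⟩
  obtain ⟨i, rfl⟩ := hb.mem_range x hx (hl x ▸ h)
  exact ⟨σ i, by simp⟩

lemma IsFacetBasis.level_nonpos (hb : IsFacetBasis V b) {x : Fin d → ℤ} (hx : x ∈ V)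
    (h : x ∉ Set.range b) : level b x ≤ 0 := by
  have h1 := hb.level_le x hx
  have h2 : level b x ≠ 1 := fun h2 => h (hb.mem_range x hx h2)
  omega

/-- The change of coordinates between two adjacent facets. -/
lemma IsFacetBasis.neighbor_coords (hb : IsFacetBasis V b) (hb' : IsFacetBasis V b') {i : Fin d}
    (hj : ∀ j, j ≠ i → b' j = b j) (hi : b' i ≠ b i) :
    level b (b' i) ≤ 0 ∧ b.repr (b' i) i = -1 ∧ (∀ x, b'.repr x i = -b.repr x i) ∧
      (∀ x j, j ≠ i → b'.repr x j = b.repr x j + b.repr x i * b.repr (b' i) j) ∧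
      ∀ x, level b' x = level b x - b.repr x i * (1 - level b (b' i)) := by
  have hr : b' i ∉ Set.range b := by
    rintro ⟨j, hij⟩
    by_cases h : j = i
    · subst h; exact hi hij.symm
    · exact h (b'.injective ((hj j h).trans hij))
  have h0 := hb.level_nonpos (hb'.mem i) hr
  have c1 : ∀ x, b.repr x i = b'.repr x i * b.repr (b' i) i := fun x => by
    rw [repr_eq_sum_repr b b', Finset.sum_eq_single i]
    · intro j _ h; rw [hj j h]; simp [h]
    · simp
  have c2 : ∀ x j, j ≠ i → b.repr x j = b'.repr x j + b'.repr x i * b.repr (b' i) j :=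
      fun x j h => by
    rw [repr_eq_sum_repr b b', ← Finset.add_sum_erase _ _ (Finset.mem_univ i),
      Finset.sum_eq_single j]
    · rw [hj j h]; simp; ring
    · intro k hk hkj; rw [hj k (Finset.ne_of_mem_erase hk)]; simp [hkj]
    · simp [h]
  have c3 : ∀ x, level b x = level b' x + b'.repr x i * (level b (b' i) - 1) := fun x => by
    rw [level_eq_sum_repr b b', level, ← Finset.add_sum_erase _ _ (Finset.mem_univ i),
      ← Finset.add_sum_erase _ (fun i => b'.repr x i) (Finset.mem_univ i),
      Finset.sum_congr rfl (g := fun j => b'.repr x j)]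
    · ring
    · intro k hk; rw [hj k (Finset.ne_of_mem_erase hk), level_self, mul_one]
  have hk : b.repr (b' i) i = -1 := by
    have h1 := c1 (b i)
    simp only [Basis.repr_self, Finsupp.single_eq_same] at h1
    -- The coordinate is a unit because both families are lattice bases. The value 1 would put `b i`
    -- at `b'`-level at least 2.
    rcases Int.isUnit_iff.1 (IsUnit.of_mul_eq_one_right _ h1.symm) with h | h
    · have h2 := c3 (b i)
      rw [h, mul_one] at h1
      rw [level_self, ← h1] at h2
      have := hb'.level_le _ (hb.mem i)
      omega
    · exact h
  have c4 : ∀ x, b'.repr x i = -b.repr x i := fun x => by rw [c1 x, hk]; ring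
  refine ⟨h0, hk, c4, fun x j h => ?_, fun x => ?_⟩
  · rw [c2 x j h, c4 x]; ring
  · rw [c3 x, c4 x]; ring

/-- Crossing the ridge opposite to `b i` raises the level of `v` by a positive integer, so `v`
reaches level 1 on the adjacent facet. It is the new vertex there, since the old ones have `b`-level
1. -/
lemma IsNeighborlyFano.level_zero_coord (hV : IsNeighborlyFano V) (hb : IsFacetBasis V b)
    {v : Fin d → ℤ} (hv : v ∈ V) (h0 : level b v = 0) {i : Fin d} (hi : b.repr v i < 0) :
    b.repr v i = -1 ∧ ∃ b', IsFacetBasis V b' ∧ b' i = v ∧ (∀ j, j ≠ i → b' j = b j) ∧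
      (∀ x, b'.repr x i = -b.repr x i) ∧
      (∀ x j, j ≠ i → b'.repr x j = b.repr x j + b.repr x i * b.repr v j) ∧
      ∀ x, level b' x = level b x - b.repr x i := by
  obtain ⟨b', hb', hj, hne⟩ := hV.exists_neighbor b hb i
  obtain ⟨h1, h2, h3, h4, h5⟩ := hb.neighbor_coords hb' hj hne
  have h6 := h5 v
  have h7 := hb'.level_le v hv
  have h8 : level b' v = 1 := by nlinarith
  obtain ⟨j, rfl⟩ := hb'.mem_range v hv h8
  have hji : j = i := by
    by_contra h
    rw [hj j h, level_self] at h0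
    omega
  subst hji
  refine ⟨h2, b', hb', rfl, hj, h3, h4, fun x => ?_⟩
  rw [h5 x, h0]; ring

lemma IsNeighborlyFano.level_zero_unique (hV : IsNeighborlyFano V) (hb : IsFacetBasis V b)
    {v w : Fin d → ℤ} (hv : v ∈ V) (hw : w ∈ V) (h0 : level b v = 0) (h0' : level b w = 0)
    {i : Fin d} (hi : b.repr v i < 0) (hi' : b.repr w i < 0) : v = w := by
  obtain ⟨-, b', hb', rfl, hj, -, -, h5⟩ := hV.level_zero_coord hb hv h0 hi
  obtain ⟨hm, -⟩ := hV.level_zero_coord hb hw h0' hi'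
  have h6 := h5 w
  obtain ⟨j, rfl⟩ := hb'.mem_range w hw (by omega)
  by_cases h : j = i
  · rw [h]
  · rw [hj j h, level_self] at h0'
    omega

/-- A coordinate of -2 or less would lift `x` to level 1 on the adjacent facet. There `x` could only
be the new vertex, whose i-th coordinate is -1. -/
lemma IsNeighborlyFano.neg_one_le_repr (hV : IsNeighborlyFano V) (hb : IsFacetBasis V b)
    {x : Fin d → ℤ} (hx : x ∈ V) (h : -1 ≤ level b x) (h0 : level b x ≤ 0) (i : Fin d) :
    -1 ≤ b.repr x i := by
  by_contra! hi
  obtain ⟨b', hb', hj, hne⟩ := hV.exists_neighbor b hb i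
  obtain ⟨h1, h2, h3, h4, h5⟩ := hb.neighbor_coords hb' hj hne
  have h6 := h5 x
  have h7 := hb'.level_le x hx
  have h8 : level b' x = 1 := by nlinarith
  obtain ⟨j, rfl⟩ := hb'.mem_range x hx h8
  by_cases hji : j = i
  · subst hji; omega
  · rw [hj j hji, level_self] at h0
    omega

/-- A vertex with at most one negative coordinate with respect to a facet is opposite to a vertex of
the facet. -/
lemma IsNeighborlyFano.eq_neg_of_nonneg (hV : IsNeighborlyFano V) (hb : IsFacetBasis V b)
    {x : Fin d → ℤ} (hx : x ∈ V) (h0 : level b x ≤ 0) (i : Fin d)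
    (hi : ∀ j, j ≠ i → 0 ≤ b.repr x j) : x = -b i := by
  by_contra hne
  obtain ⟨g, hg, ⟨p, hp⟩, ⟨q, hq⟩⟩ := hV.exists_common x hx (b i) (hb.mem i)
    (fun h => by rw [h, level_self] at h0; omega) (fun h => hne (eq_neg_of_add_eq_zero_left h))
  -- The form of `g` is at most 1 on every `b j` and exactly 1 on `b i`, the only place where the
  -- coefficient of `x` may be negative.
  have h1 : level g x ≤ level b x := by
    rw [level_eq_sum_repr g b, level]
    refine Finset.sum_le_sum fun j _ => ?_
    by_cases h : j = i
    · rw [h, ← hq, level_self, mul_one]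
    · have h1 := hi j h
      have h2 := hg.level_le _ (hb.mem j)
      nlinarith
  rw [← hp, level_self, hp] at h1
  omega

/-- On a facet common to `x` and `y` the sum would have level 2. -/
lemma IsNeighborlyFano.add_notMem (hV : IsNeighborlyFano V) {x y : Fin d → ℤ} (hx : x ∈ V)
    (hy : y ∈ V) (hxy : x ≠ y) (h0 : x + y ≠ 0) : x + y ∉ V := by
  intro hz
  obtain ⟨g, hg, ⟨p, rfl⟩, ⟨q, rfl⟩⟩ := hV.exists_common x hx y hy hxy h0
  have := hg.level_le _ hz
  rw [level_add, level_self, level_self] at this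
  omega

/-- On a facet common to `x` and `y` both sides have level 2, so `z` and `w` are vertices of that
facet too, and linear independence applies. -/
lemma IsNeighborlyFano.eq_or_eq_of_add_eq_add (hV : IsNeighborlyFano V) {x y z w : Fin d → ℤ}
    (hx : x ∈ V) (hy : y ∈ V) (hz : z ∈ V) (hw : w ∈ V) (hxy : x ≠ y) (h0 : x + y ≠ 0)
    (h : x + y = z + w) : z = x ∨ z = y := by
  obtain ⟨g, hg, ⟨p, rfl⟩, ⟨q, rfl⟩⟩ := hV.exists_common x hx y hy hxy h0
  have h1 := congrArg (level g) h
  rw [level_add, level_add, level_self, level_self] at h1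
  have h2 := hg.level_le _ hz
  have h3 := hg.level_le _ hw
  obtain ⟨r, rfl⟩ := hg.mem_range z hz (by omega)
  obtain ⟨s, rfl⟩ := hg.mem_range w hw (by omega)
  have h4 := congrArg (fun x => g.repr x r) h
  by_contra! hne
  have hp : p ≠ r := fun h => hne.1 (h ▸ rfl)
  have hq : q ≠ r := fun h => hne.2 (h ▸ rfl)
  simp only [map_add, Basis.repr_self, Finsupp.add_apply, Finsupp.single_eq_same,
    Finsupp.single_apply, hp, hq, if_false] at h4
  split_ifs at h4 <;> omega

end General

/-! ### Counting vertices by level in dimension four -/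

section Counting

variable {V : Finset (Fin 4 → ℤ)} {b : Basis (Fin 4) ℤ (Fin 4 → ℤ)}

lemma level_four (b : Basis (Fin 4) ℤ (Fin 4 → ℤ)) (x : Fin 4 → ℤ) :
    level b x = b.repr x 0 + b.repr x 1 + b.repr x 2 + b.repr x 3 :=
  Fin.sum_univ_four _

lemma ext_four (b : Basis (Fin 4) ℤ (Fin 4 → ℤ)) {x y : Fin 4 → ℤ}
    (h0 : b.repr x 0 = b.repr y 0) (h1 : b.repr x 1 = b.repr y 1)
    (h2 : b.repr x 2 = b.repr y 2) (h3 : b.repr x 3 = b.repr y 3) : x = y := by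
  refine b.ext_elem fun i => ?_
  fin_cases i <;> assumption

/-- The vertices at level zero. -/
noncomputable def levelZero (V : Finset (Fin 4 → ℤ)) (b : Basis (Fin 4) ℤ (Fin 4 → ℤ)) :
    Finset (Fin 4 → ℤ) := V.filter fun x => level b x = 0

/-- The vertices at negative levels. -/
noncomputable def levelNeg (V : Finset (Fin 4 → ℤ)) (b : Basis (Fin 4) ℤ (Fin 4 → ℤ)) :
    Finset (Fin 4 → ℤ) := V.filter fun x => level b x < 0

lemma mem_levelZero {x : Fin 4 → ℤ} : x ∈ levelZero V b ↔ x ∈ V ∧ level b x = 0 := by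
  simp [levelZero]

lemma mem_levelNeg {x : Fin 4 → ℤ} : x ∈ levelNeg V b ↔ x ∈ V ∧ level b x < 0 := by
  simp [levelNeg]

lemma IsFacetBasis.mem_iff (hb : IsFacetBasis V b) {x : Fin 4 → ℤ} :
    x ∈ V ↔ x ∈ Set.range b ∨ x ∈ levelZero V b ∨ x ∈ levelNeg V b := by
  rw [mem_levelZero, mem_levelNeg]
  constructor
  · intro hx
    by_cases h : x ∈ Set.range b
    · exact Or.inl h
    · have := hb.level_nonpos hx h
      rcases this.eq_or_lt with h | h
      · exact Or.inr (Or.inl ⟨hx, h⟩)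
      · exact Or.inr (Or.inr ⟨hx, h⟩)
  · rintro (⟨i, rfl⟩ | h | h)
    exacts [hb.mem i, h.1, h.1]

lemma IsFacetBasis.sum_eq {M : Type*} [AddCommMonoid M] (hb : IsFacetBasis V b)
    (f : (Fin 4 → ℤ) → M) :
    ∑ x ∈ V, f x = ∑ i, f (b i) + ∑ x ∈ levelZero V b, f x + ∑ x ∈ levelNeg V b, f x := by
  classical
  have h1 : V = (Finset.univ.image b ∪ levelZero V b) ∪ levelNeg V b := by
    ext x
    rw [hb.mem_iff, Finset.mem_union, Finset.mem_union, or_assoc]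
    simp
  have h2 : Disjoint (Finset.univ.image b) (levelZero V b) := by
    rw [Finset.disjoint_left]
    intro x hx
    obtain ⟨i, -, rfl⟩ := Finset.mem_image.1 hx
    simp [mem_levelZero, level_self]
  have h3 : Disjoint (Finset.univ.image b ∪ levelZero V b) (levelNeg V b) := by
    rw [Finset.disjoint_left]
    intro x hx
    rcases Finset.mem_union.1 hx with hx | hx
    · obtain ⟨i, -, rfl⟩ := Finset.mem_image.1 hx
      simp [mem_levelNeg, level_self]
    · simp [mem_levelNeg, (mem_levelZero.1 hx).2]
  conv_lhs => rw [h1]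
  rw [Finset.sum_union h3, Finset.sum_union h2, Finset.sum_image (fun _ _ _ _ h => b.injective h)]

lemma IsFacetBasis.card_eq (hb : IsFacetBasis V b) :
    V.card = 4 + (levelZero V b).card + (levelNeg V b).card := by
  simpa using hb.sum_eq fun _ => (1 : ℕ)

lemma IsFacetBasis.level_sum_eq (hb : IsFacetBasis V b) :
    level b (∑ x ∈ V, x) = 4 + ∑ x ∈ levelNeg V b, level b x := by
  have h1 : ∑ x ∈ levelZero V b, level b x = 0 :=
    Finset.sum_eq_zero fun x hx => (mem_levelZero.1 hx).2
  rw [level_sum, hb.sum_eq (level b), h1]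
  simp [level_self]

/-- The left side is the sum of level + 1 over all vertices of negative level. Each term is at most
0, so keeping only `T` increases the sum. The choices of `T` with 0, 1 and 2 elements give the three
bounds below. -/
lemma IsFacetBasis.level_subset (hb : IsFacetBasis V b) {T : Finset (Fin 4 → ℤ)}
    (hT : T ⊆ levelNeg V b) :
    level b (∑ x ∈ V, x) + (levelNeg V b).card - 4 ≤ ∑ x ∈ T, (level b x + 1) := by
  have h1 : ∑ x ∈ levelNeg V b, (level b x + 1) ≤ ∑ x ∈ T, (level b x + 1) :=
    Finset.sum_le_sum_of_subset_of_nonpos' hT fun x hx _ => by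
      have := (mem_levelNeg.1 hx).2
      omega
  rw [Finset.sum_add_distrib] at h1
  have h2 := hb.level_sum_eq
  simp only [Finset.sum_const, nsmul_eq_mul, mul_one] at h1
  omega

/-- The indices of the negative coordinates. -/
noncomputable def negCoords (b : Basis (Fin 4) ℤ (Fin 4 → ℤ)) (x : Fin 4 → ℤ) :
    Finset (Fin 4) := Finset.univ.filter fun i => b.repr x i < 0

lemma mem_negCoords {x : Fin 4 → ℤ} {i : Fin 4} : i ∈ negCoords b x ↔ b.repr x i < 0 := by
  simp [negCoords]

lemma IsNeighborlyFano.two_le_card_negCoords (hV : IsNeighborlyFano V) (hb : IsFacetBasis V b)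
    {x : Fin 4 → ℤ} (hx : x ∈ V) (h0 : level b x = 0) : 2 ≤ (negCoords b x).card := by
  by_contra! h
  obtain ⟨i, hi⟩ := Finset.card_le_one_iff_subset_singleton.1 (Nat.le_of_lt_succ h)
  have h1 : x = -b i := hV.eq_neg_of_nonneg hb hx h0.le i fun j hj => by
    by_contra! hlt
    exact hj (Finset.mem_singleton.1 (hi (mem_negCoords.2 hlt)))
  rw [h1, level_neg, level_self] at h0
  omega

lemma IsNeighborlyFano.disjoint_negCoords (hV : IsNeighborlyFano V) (hb : IsFacetBasis V b)
    {x y : Fin 4 → ℤ} (hx : x ∈ levelZero V b) (hy : y ∈ levelZero V b) (hxy : x ≠ y) :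
    Disjoint (negCoords b x) (negCoords b y) := by
  rw [Finset.disjoint_left]
  intro i hi hi'
  exact hxy (hV.level_zero_unique hb (mem_levelZero.1 hx).1 (mem_levelZero.1 hy).1
    (mem_levelZero.1 hx).2 (mem_levelZero.1 hy).2 (mem_negCoords.1 hi) (mem_negCoords.1 hi'))

lemma IsNeighborlyFano.card_levelZero_le (hV : IsNeighborlyFano V) (hb : IsFacetBasis V b) :
    (levelZero V b).card ≤ 2 := by
  have h1 : ((levelZero V b).biUnion (negCoords b)).card = ∑ x ∈ levelZero V b,
      (negCoords b x).card :=
    Finset.card_biUnion fun x hx y hy hxy => hV.disjoint_negCoords hb hx hy hxy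
  have h2 : ((levelZero V b).biUnion (negCoords b)).card ≤ 4 := by
    simpa using Finset.card_le_univ ((levelZero V b).biUnion (negCoords b))
  have h3 : (levelZero V b).card • 2 ≤ ∑ x ∈ levelZero V b, (negCoords b x).card :=
    Finset.card_nsmul_le_sum _ _ _ fun x hx =>
      hV.two_le_card_negCoords hb (mem_levelZero.1 hx).1 (mem_levelZero.1 hx).2
  rw [smul_eq_mul] at h3
  omega

lemma IsFacetBasis.level_sum_add_card_le (hb : IsFacetBasis V b) :
    level b (∑ x ∈ V, x) + V.card ≤ 8 + (levelZero V b).card := by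
  have h1 := hb.card_eq
  have h3 := hb.level_subset (Finset.empty_subset _)
  rw [Finset.sum_empty] at h3
  omega

lemma IsFacetBasis.le_level (hb : IsFacetBasis V b)
    {x : Fin 4 → ℤ} (hx : x ∈ V) :
    level b (∑ x ∈ V, x) + V.card ≤ level b x + 9 + (levelZero V b).card := by
  have h1 := hb.card_eq
  have h2 := hb.level_sum_add_card_le
  by_cases h : level b x < 0
  · have h3 := hb.level_subset (Finset.singleton_subset_iff.2 (mem_levelNeg.2 ⟨hx, h⟩))
    rw [Finset.sum_singleton] at h3
    omega
  · omega

lemma IsNeighborlyFano.le_level_add_level (hV : IsNeighborlyFano V) (hb : IsFacetBasis V b)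
    {x y : Fin 4 → ℤ} (hx : x ∈ V) (hy : y ∈ V) (hxy : x ≠ y) (hx0 : level b x < 0)
    (hy0 : level b y < 0) :
    level b (∑ x ∈ V, x) + V.card ≤ level b x + level b y + 12 := by
  classical
  have h1 := hb.card_eq
  have h2 := hV.card_levelZero_le hb
  have h3 := hb.level_subset (T := {x, y}) (Finset.insert_subset_iff.2
    ⟨mem_levelNeg.2 ⟨hx, hx0⟩, Finset.singleton_subset_iff.2 (mem_levelNeg.2 ⟨hy, hy0⟩)⟩)
  rw [Finset.sum_pair hxy] at h3
  omega

lemma IsNeighborlyFano.card_le (hV : IsNeighborlyFano V) : V.card ≤ 10 := by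
  obtain ⟨b, hb, hs⟩ := hV.exists_cone (∑ x ∈ V, x)
  have h1 := hb.level_sum_add_card_le
  have h2 := hV.card_levelZero_le hb
  have h3 : 0 ≤ level b (∑ x ∈ V, x) := Finset.sum_nonneg fun i _ => hs i
  omega

/-- A facet with two vertices `v` and `w` at level zero, in a normalized order. -/
structure IsTwoLevelZero (V : Finset (Fin 4 → ℤ)) (b : Basis (Fin 4) ℤ (Fin 4 → ℤ))
    (v w : Fin 4 → ℤ) : Prop where
  facet : IsFacetBasis V b
  mem_left : v ∈ V
  mem_right : w ∈ V
  level_left : level b v = 0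
  level_right : level b w = 0
  left_two : b.repr v 2 = -1
  left_three : b.repr v 3 = -1
  right_zero : b.repr w 0 = -1
  right_one : b.repr w 1 = -1
  left_zero_nonneg : 0 ≤ b.repr v 0
  left_one_nonneg : 0 ≤ b.repr v 1
  right_two_nonneg : 0 ≤ b.repr w 2
  right_three_nonneg : 0 ≤ b.repr w 3

/-- Used to normalize the positions of the negative coordinates. The freedom to send 0 to `i` is
needed when the vertex sum is `b i`. -/
lemma exists_perm_of_disjoint {S T : Finset (Fin 4)} (hS : 2 ≤ S.card) (hT : 2 ≤ T.card)
    (h : Disjoint S T) {i : Fin 4} (hi : i ∈ T) : ∃ σ : Equiv.Perm (Fin 4), σ 0 = i ∧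
      σ 1 ∈ T ∧ σ 2 ∈ S ∧ σ 3 ∈ S := by
  obtain ⟨k, hk, hki⟩ := Finset.exists_mem_ne (show 1 < T.card by omega) i
  obtain ⟨s, hs, t, ht, hst⟩ := Finset.one_lt_card.1 hS
  have hd : ∀ x ∈ S, ∀ y ∈ T, x ≠ y := fun x hx y hy hxy => Finset.disjoint_left.1 h hx (hxy ▸ hy)
  have hinj : Function.Injective ![i, k, s, t] := by
    intro x y hxy
    have h1 := hd s hs i hi
    have h2 := hd s hs k hk
    have h3 := hd t ht i hi
    have h4 := hd t ht k hk
    fin_cases x <;> fin_cases y <;> simp_all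
  exact ⟨Equiv.ofBijective _ (Finite.injective_iff_bijective.1 hinj), rfl, hk, hs, ht⟩

/-- Two disjoint sets of at least two negative coordinates each partition the four indices into
pairs. The names `v` and `w` are chosen so that `i` belongs to the pair of `w`. -/
lemma IsNeighborlyFano.exists_isTwoLevelZero (hV : IsNeighborlyFano V) (hb : IsFacetBasis V b)
    (h2 : (levelZero V b).card = 2) (i : Fin 4) : ∃ (σ : Equiv.Perm (Fin 4)) (v w : Fin 4 → ℤ),
      σ 0 = i ∧ IsTwoLevelZero V (b.reindex σ.symm) v w := by
  obtain ⟨v, w, hvw, hL⟩ := Finset.card_eq_two.1 h2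
  have hv : v ∈ levelZero V b := by simp [hL]
  have hw : w ∈ levelZero V b := by simp [hL]
  clear hL
  have key : i ∈ negCoords b v ∨ i ∈ negCoords b w := by
    have h1 := hV.two_le_card_negCoords hb (mem_levelZero.1 hv).1 (mem_levelZero.1 hv).2
    have h2 := hV.two_le_card_negCoords hb (mem_levelZero.1 hw).1 (mem_levelZero.1 hw).2
    have h3 := Finset.card_union_of_disjoint (hV.disjoint_negCoords hb hv hw hvw)
    have h4 : negCoords b v ∪ negCoords b w = Finset.univ := by
      refine Finset.eq_univ_of_card _ (le_antisymm ?_ ?_)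
      · exact Finset.card_le_univ _
      · rw [Fintype.card_fin]; omega
    rw [← Finset.mem_union, h4]
    exact Finset.mem_univ i
  wlog hi : i ∈ negCoords b w generalizing v w
  · exact this w v hvw.symm hw hv key.symm (key.resolve_right hi)
  have h1 := hV.two_le_card_negCoords hb (mem_levelZero.1 hv).1 (mem_levelZero.1 hv).2
  have h2 := hV.two_le_card_negCoords hb (mem_levelZero.1 hw).1 (mem_levelZero.1 hw).2
  have hd := hV.disjoint_negCoords hb hv hw hvw
  obtain ⟨σ, hσ, hσ1, hσ2, hσ3⟩ := exists_perm_of_disjoint h1 h2 hd hi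
  rw [mem_levelZero] at hv hw
  have hlev := level_reindex b σ.symm
  have hcoord : ∀ x ∈ V, level b x = 0 → ∀ j ∈ negCoords b x, b.repr x j = -1 :=
    fun x hx h0 j hj => (hV.level_zero_coord hb hx h0 (mem_negCoords.1 hj)).1
  have hnn : ∀ x j, j ∉ negCoords b x → 0 ≤ b.repr x j := fun x j hj => by
    by_contra! h
    exact hj (mem_negCoords.2 h)
  subst hσ
  refine ⟨σ, v, w, rfl, hb.reindex _, hv.1, hw.1, ?_, ?_, ?_, ?_, ?_, ?_, ?_, ?_, ?_, ?_⟩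
  · rw [hlev, hv.2]
  · rw [hlev, hw.2]
  · simpa using hcoord v hv.1 hv.2 _ hσ2
  · simpa using hcoord v hv.1 hv.2 _ hσ3
  · simpa using hcoord w hw.1 hw.2 _ hi
  · simpa using hcoord w hw.1 hw.2 _ hσ1
  · simpa using hnn v _ (Finset.disjoint_right.1 hd hi)
  · simpa using hnn v _ (Finset.disjoint_right.1 hd hσ1)
  · simpa using hnn w _ (Finset.disjoint_left.1 hd hσ2)
  · simpa using hnn w _ (Finset.disjoint_left.1 hd hσ3)

/-- This and the next two lemmas are the symmetries of the normal form; they cut the case analysis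
in `IsDeep.false` from six cases to two. -/
lemma IsTwoLevelZero.reindex_swap_left {v w : Fin 4 → ℤ} (h : IsTwoLevelZero V b v w) :
    IsTwoLevelZero V (b.reindex (Equiv.swap 0 1)) v w := by
  obtain ⟨h1, h2, h3, h4, h5, h6, h7, h8, h9, h10, h11, h12, h13⟩ := h
  have e0 : (Equiv.swap (0 : Fin 4) 1) 0 = 1 := rfl
  have e1 : (Equiv.swap (0 : Fin 4) 1) 1 = 0 := rfl
  have e2 : (Equiv.swap (0 : Fin 4) 1) 2 = 2 := rfl
  have e3 : (Equiv.swap (0 : Fin 4) 1) 3 = 3 := rfl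
  rw [level_four] at h4 h5
  refine ⟨h1.reindex _, h2, h3, ?_, ?_, ?_, ?_, ?_, ?_, ?_, ?_, ?_, ?_⟩ <;>
    simp only [level_four, Basis.repr_reindex_apply, Equiv.symm_swap, e0, e1, e2, e3] <;> omega

lemma IsTwoLevelZero.reindex_swap_right {v w : Fin 4 → ℤ} (h : IsTwoLevelZero V b v w) :
    IsTwoLevelZero V (b.reindex (Equiv.swap 2 3)) v w := by
  obtain ⟨h1, h2, h3, h4, h5, h6, h7, h8, h9, h10, h11, h12, h13⟩ := h
  have e0 : (Equiv.swap (2 : Fin 4) 3) 0 = 0 := rfl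
  have e1 : (Equiv.swap (2 : Fin 4) 3) 1 = 1 := rfl
  have e2 : (Equiv.swap (2 : Fin 4) 3) 2 = 3 := rfl
  have e3 : (Equiv.swap (2 : Fin 4) 3) 3 = 2 := rfl
  rw [level_four] at h4 h5
  refine ⟨h1.reindex _, h2, h3, ?_, ?_, ?_, ?_, ?_, ?_, ?_, ?_, ?_, ?_⟩ <;>
    simp only [level_four, Basis.repr_reindex_apply, Equiv.symm_swap, e0, e1, e2, e3] <;> omega

lemma IsTwoLevelZero.reindex_add_two {v w : Fin 4 → ℤ} (h : IsTwoLevelZero V b v w) :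
    IsTwoLevelZero V (b.reindex (Equiv.addRight 2)) w v := by
  obtain ⟨h1, h2, h3, h4, h5, h6, h7, h8, h9, h10, h11, h12, h13⟩ := h
  have e0 : (Equiv.addRight (2 : Fin 4)).symm 0 = 2 := rfl
  have e1 : (Equiv.addRight (2 : Fin 4)).symm 1 = 3 := rfl
  have e2 : (Equiv.addRight (2 : Fin 4)).symm 2 = 0 := rfl
  have e3 : (Equiv.addRight (2 : Fin 4)).symm 3 = 1 := rfl
  rw [level_four] at h4 h5
  refine ⟨h1.reindex _, h3, h2, ?_, ?_, ?_, ?_, ?_, ?_, ?_, ?_, ?_, ?_⟩ <;>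
    simp only [level_four, Basis.repr_reindex_apply, e0, e1, e2, e3] <;> omega

lemma IsTwoLevelZero.ne {v w : Fin 4 → ℤ} (h : IsTwoLevelZero V b v w) : v ≠ w := by
  rintro rfl
  have h1 := h.left_zero_nonneg
  have h2 := h.right_zero
  omega

lemma IsNeighborlyFano.levelZero_eq (hV : IsNeighborlyFano V) {v w : Fin 4 → ℤ}
    (h : IsTwoLevelZero V b v w) : levelZero V b = {v, w} := by
  symm
  refine Finset.eq_of_subset_of_card_le ?_ ?_
  · rw [Finset.insert_subset_iff, Finset.singleton_subset_iff]
    exact ⟨mem_levelZero.2 ⟨h.mem_left, h.level_left⟩, mem_levelZero.2 ⟨h.mem_right, h.level_right⟩⟩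
  · rw [Finset.card_pair h.ne]
    exact hV.card_levelZero_le h.facet

end Counting

/-! ### Ten vertices, and nine vertices with nonzero sum -/

section Classification

variable {V : Finset (Fin 4 → ℤ)} {b : Basis (Fin 4) ℤ (Fin 4 → ℤ)} {v w x y z : Fin 4 → ℤ}

lemma eq_neg_zero (h0 : b.repr x 0 = -1) (h1 : b.repr x 1 = 0) (h2 : b.repr x 2 = 0)
    (h3 : b.repr x 3 = 0) : x = -b 0 := by
  apply ext_four b <;> simp [h0, h1, h2, h3]

lemma eq_neg_one (h0 : b.repr x 0 = 0) (h1 : b.repr x 1 = -1) (h2 : b.repr x 2 = 0)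
    (h3 : b.repr x 3 = 0) : x = -b 1 := by
  apply ext_four b <;> simp [h0, h1, h2, h3]

lemma eq_neg_two (h0 : b.repr x 0 = 0) (h1 : b.repr x 1 = 0) (h2 : b.repr x 2 = -1)
    (h3 : b.repr x 3 = 0) : x = -b 2 := by
  apply ext_four b <;> simp [h0, h1, h2, h3]

lemma eq_neg_three (h0 : b.repr x 0 = 0) (h1 : b.repr x 1 = 0) (h2 : b.repr x 2 = 0)
    (h3 : b.repr x 3 = -1) : x = -b 3 := by
  apply ext_four b <;> simp [h0, h1, h2, h3]

lemma exists_eq_neg_of_nonpos (h : level b x = -1) (h0 : b.repr x 0 ≤ 0) (h1 : b.repr x 1 ≤ 0)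
    (h2 : b.repr x 2 ≤ 0) (h3 : b.repr x 3 ≤ 0) : ∃ i, x = -b i := by
  rw [level_four] at h
  by_cases c0 : b.repr x 0 = -1
  · exact ⟨0, eq_neg_zero c0 (by omega) (by omega) (by omega)⟩
  by_cases c1 : b.repr x 1 = -1
  · exact ⟨1, eq_neg_one (by omega) c1 (by omega) (by omega)⟩
  by_cases c2 : b.repr x 2 = -1
  · exact ⟨2, eq_neg_two (by omega) (by omega) c2 (by omega)⟩
  · exact ⟨3, eq_neg_three (by omega) (by omega) (by omega) (by omega)⟩

lemma exists_eq_unitsSMul_or_neg (b : Basis (Fin 4) ℤ (Fin 4 → ℤ)) (u : Fin 4 → ℤˣ)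
    (x : Fin 4 → ℤ) :
    (∃ i, x = b.unitsSMul u i ∨ x = -b.unitsSMul u i) ↔ ∃ i, x = b i ∨ x = -b i := by
  refine exists_congr fun i => ?_
  rw [Basis.unitsSMul_apply]
  rcases Int.units_eq_one_or (u i) with h | h <;> simp [h, or_comm]

/-- This is `neg_one_le_repr` on the adjacent facet that contains `v`, in the coordinates of `b`;
the two inequalities say that `x` has level -1 or 0 there. -/
lemma IsNeighborlyFano.neg_one_le_neighbor_repr (hV : IsNeighborlyFano V)
    (hb : IsFacetBasis V b) (hv : v ∈ V) (h0 : level b v = 0) {i : Fin 4} (hi : b.repr v i = -1)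
    (hx : x ∈ V) (h1 : level b x ≤ b.repr x i) (h2 : b.repr x i ≤ level b x + 1) {j : Fin 4}
    (hj : j ≠ i) : -1 ≤ b.repr x j + b.repr x i * b.repr v j := by
  obtain ⟨-, b', hb', -, -, h4, h5, h6⟩ := hV.level_zero_coord hb hv h0 (hi.trans_lt (by norm_num))
  have h7 := h6 x
  rw [← h5 x j hj]
  exact hV.neg_one_le_repr hb' hx (by omega) (by omega) j

/-- The classification of the neighborly Fano vertex sets with ten elements. -/
lemma IsNeighborlyFano.classification_ten (hV : IsNeighborlyFano V) (hc : V.card = 10) :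
    ∃ g : Basis (Fin 4) ℤ (Fin 4 → ℤ), ∀ x, x ∈ V ↔
      (∃ i, x = g i ∨ x = -g i) ∨ x = ∑ i, g i ∨ x = -∑ i, g i := by
  classical
  obtain ⟨b₀, hb₀, hs⟩ := hV.exists_cone (∑ x ∈ V, x)
  have h1 := hb₀.level_sum_add_card_le
  have h2 := hV.card_levelZero_le hb₀
  have hν : ∑ x ∈ V, x = 0 := by
    have := hs 0
    have := hs 1
    have := hs 2
    have := hs 3
    rw [level_four] at h1
    apply ext_four b₀ <;> simp only [map_zero, Finsupp.zero_apply] <;> omega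
  -- Since the vertex sum is 0, it lies in the cone over every facet, so the estimate is available
  -- for all of them.
  have hlev : ∀ b, IsFacetBasis V b → ∀ x ∈ V, -1 ≤ level b x := fun b hb x hx => by
    have h3 := hb.le_level hx
    have h4 := hV.card_levelZero_le hb
    rw [hν, level_zero] at h3
    omega
  rw [hν, level_zero] at h1
  obtain ⟨σ, v, w, -, h⟩ := hV.exists_isTwoLevelZero hb₀ (by omega) 0
  generalize b₀.reindex σ.symm = b at h
  clear hs h1 h2 hb₀
  have hflip : ∀ x ∈ V, ∀ u ∈ V, level b u = 0 → ∀ i, b.repr u i = -1 → level b x = -1 →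
      b.repr x i ≤ 0 := fun x hx u hu hu0 i hi hx1 => by
    obtain ⟨-, b', hb', -, -, -, -, h6⟩ :=
      hV.level_zero_coord h.facet hu hu0 (hi.trans_lt (by norm_num))
    have h7 := hlev b' hb' x hx
    have h8 := h6 x
    omega
  have hL := hV.levelZero_eq h
  have hN : levelNeg V b = Finset.univ.image fun i => -b i := by
    refine Finset.eq_of_subset_of_card_le (fun x hx => ?_) ?_
    · obtain ⟨hx, hx0⟩ := mem_levelNeg.1 hx
      have hx1 : level b x = -1 := by
        have := hlev b h.facet x hx
        omega
      obtain ⟨i, rfl⟩ := exists_eq_neg_of_nonpos hx1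
        (hflip x hx w h.mem_right h.level_right 0 h.right_zero hx1)
        (hflip x hx w h.mem_right h.level_right 1 h.right_one hx1)
        (hflip x hx v h.mem_left h.level_left 2 h.left_two hx1)
        (hflip x hx v h.mem_left h.level_left 3 h.left_three hx1)
      simp
    · have h3 := h.facet.card_eq
      rw [hL, Finset.card_pair h.ne] at h3
      rw [Finset.card_image_of_injective _ (f := fun i => -b i) (neg_injective.comp b.injective),
        Finset.card_univ,
        Fintype.card_fin]
      omega
  have hinj : ∀ x ∈ (Finset.univ : Finset (Fin 4)), ∀ y ∈ (Finset.univ : Finset (Fin 4)),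
      -b x = -b y → x = y := fun x _ y _ hxy => b.injective (neg_injective hxy)
  have hvw : w = -v := by
    have h3 := h.facet.sum_eq fun x => x
    rw [hL, hN, Finset.sum_image hinj, Finset.sum_pair h.ne, hν, Finset.sum_neg_distrib] at h3
    refine eq_neg_of_add_eq_zero_right ?_
    rw [h3]; abel
  have hw0 := h.right_zero
  have hw1 := h.right_one
  simp only [hvw, map_neg, Finsupp.neg_apply, neg_inj] at hw0 hw1
  have hv2 := h.left_two
  have hv3 := h.left_three
  -- In the basis `b` the vertex `v` is (1, 1, -1, -1); changing two signs turns it into the sum of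
  -- the basis.
  have hsum : ∑ i, b.unitsSMul ![1, 1, -1, -1] i = v := by
    apply ext_four b <;> simp [Fin.sum_univ_four, Basis.unitsSMul_apply, hw0, hw1, hv2, hv3]
  refine ⟨b.unitsSMul ![1, 1, -1, -1], fun x => ?_⟩
  rw [exists_eq_unitsSMul_or_neg, hsum, h.facet.mem_iff, hL, hN, hvw]
  simp only [Set.mem_range, Finset.mem_insert, Finset.mem_singleton, Finset.mem_image,
    Finset.mem_univ, true_and, exists_or, eq_comm (a := x)]
  tauto

/-- Collects the linear constraints on a vertex of negative level from which `coords_of_sum_eq` is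
integer arithmetic. On a facet through `b 0` the vertex sum has level 1, so all levels there are at
least -1; crossing at index 1, 2 or 3 keeps `b 0`. -/
lemma IsNeighborlyFano.levelNeg_coords_of_sum_eq (hV : IsNeighborlyFano V)
    (hc : V.card = 9) (h : IsTwoLevelZero V b v w) (hν : ∑ x ∈ V, x = b 0) :
    ∀ x ∈ levelNeg V b, b.repr x 0 + b.repr x 1 + b.repr x 2 + b.repr x 3 = -1 ∧
      (-1 ≤ b.repr x 0 ∧ -1 ≤ b.repr x 1 ∧ -1 ≤ b.repr x 2 ∧ -1 ≤ b.repr x 3) ∧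
      (b.repr x 1 ≤ 0 ∧ b.repr x 2 ≤ 0 ∧ b.repr x 3 ≤ 0) ∧
      (b.repr x 2 = -1 → -1 ≤ b.repr x 0 - b.repr v 0 ∧ -1 ≤ b.repr x 1 - b.repr v 1) ∧
      (b.repr x 3 = -1 → -1 ≤ b.repr x 0 - b.repr v 0 ∧ -1 ≤ b.repr x 1 - b.repr v 1) ∧
      (b.repr x 1 = -1 → -1 ≤ b.repr x 2 - b.repr w 2 ∧ -1 ≤ b.repr x 3 - b.repr w 3) ∧
      ¬ (b.repr x 0 = b.repr v 0 ∧ b.repr x 1 = b.repr v 1 - 1 ∧ b.repr x 2 = -1 ∧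
        b.repr x 3 = -1) := by
  have hlev : ∀ b', IsFacetBasis V b' → b' 0 = b 0 → ∀ x ∈ V, -1 ≤ level b' x :=
      fun b' hb h0 x hx => by
    have h3 := hb.le_level hx
    have h4 := hV.card_levelZero_le hb
    rw [hν, ← h0, level_self] at h3
    omega
  have hflip : ∀ x ∈ V, ∀ u ∈ V, level b u = 0 → ∀ i, i ≠ 0 → b.repr u i = -1 → level b x = -1 →
      b.repr x i ≤ 0 := fun x hx u hu hu0 i hi0 hi hx1 => by
    obtain ⟨-, b', hb', -, h5, -, -, h6⟩ :=
      hV.level_zero_coord h.facet hu hu0 (hi.trans_lt (by norm_num))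
    have h7 := hlev b' hb' (h5 0 hi0.symm) x hx
    have h8 := h6 x
    omega
  have hv0 := h.left_zero_nonneg
  have hv1 := h.left_one_nonneg
  have hv2 := h.left_two
  have hv3 := h.left_three
  have hw0 := h.right_zero
  have hw1 := h.right_one
  have hw2 := h.right_two_nonneg
  have hw3 := h.right_three_nonneg
  have hvl := h.level_left
  have hwl := h.level_right
  rw [level_four] at hvl hwl
  intro x hx
  obtain ⟨hx, hx0⟩ := mem_levelNeg.1 hx
  have hx1 : level b x = -1 := by
    have := hlev b h.facet rfl x hx
    omega
  have hN := hV.neg_one_le_repr h.facet hx hx1.ge hx0.le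
  have hA : ∀ u ∈ V, level b u = 0 → ∀ i j, j ≠ i → b.repr u i = -1 → b.repr x i = -1 →
      -1 ≤ b.repr x j - b.repr u j := fun u hu hu0 i j hij hi hxi => by
    have := hV.neg_one_le_neighbor_repr h.facet hu hu0 hi hx (by omega) (by omega) hij
    rw [hxi] at this
    omega
  refine ⟨level_four b x ▸ hx1, ⟨hN 0, hN 1, hN 2, hN 3⟩,
    ⟨hflip x hx w h.mem_right h.level_right 1 (by decide) h.right_one hx1,
    hflip x hx v h.mem_left h.level_left 2 (by decide) h.left_two hx1,
    hflip x hx v h.mem_left h.level_left 3 (by decide) h.left_three hx1⟩, fun h2 => ?_,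
    fun h3 => ?_, fun h1 => ?_, fun hE => ?_⟩
  · exact ⟨hA v h.mem_left h.level_left 2 0 (by decide) hv2 h2,
      hA v h.mem_left h.level_left 2 1 (by decide) hv2 h2⟩
  · exact ⟨hA v h.mem_left h.level_left 3 0 (by decide) hv3 h3,
      hA v h.mem_left h.level_left 3 1 (by decide) hv3 h3⟩
  · exact ⟨hA w h.mem_right h.level_right 1 2 (by decide) hw1 h1,
      hA w h.mem_right h.level_right 1 3 (by decide) hw1 h1⟩
  · have hE' : x + b 1 = v := by
      apply ext_four b <;> simp [hE, hv2, hv3]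
    refine hV.add_notMem hx (h.facet.mem 1) ?_ ?_ (hE' ▸ h.mem_left)
    · rintro rfl
      rw [level_self] at hx0
      omega
    · rintro h0
      rw [← hE', h0] at hv2
      simp at hv2

lemma IsNeighborlyFano.coords_of_sum_eq (hV : IsNeighborlyFano V)
    (hc : V.card = 9) (h : IsTwoLevelZero V b v w) (hν : ∑ x ∈ V, x = b 0) :
    b.repr v 0 = 1 ∧ b.repr w 2 = 1 ∧ ∀ x ∈ levelNeg V b, b.repr x 0 = 0 := by
  have hv0 := h.left_zero_nonneg
  have hv1 := h.left_one_nonneg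
  have hv2 := h.left_two
  have hv3 := h.left_three
  have hw0 := h.right_zero
  have hw1 := h.right_one
  have hw2 := h.right_two_nonneg
  have hw3 := h.right_three_nonneg
  have hvl := h.level_left
  have hwl := h.level_right
  rw [level_four] at hvl hwl
  have hneg := hV.levelNeg_coords_of_sum_eq hc h hν
  have hL := hV.levelZero_eq h
  have hcard := h.facet.card_eq
  rw [hL, Finset.card_pair h.ne] at hcard
  obtain ⟨x, y, z, hxy, hxz, hyz, hN⟩ := Finset.card_eq_three.1 (show (levelNeg V b).card = 3 by
    omega)
  have hx := hneg x (by simp [hN])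
  have hy := hneg y (by simp [hN])
  have hz := hneg z (by simp [hN])
  have hS := h.facet.sum_eq fun x => x
  rw [hν, hL, hN, Finset.sum_pair h.ne, Finset.sum_insert (by simp [hxy, hxz]),
    Finset.sum_pair hyz, Fin.sum_univ_four] at hS
  have hS0 := congrArg (fun u => b.repr u 0) hS
  have hS1 := congrArg (fun u => b.repr u 1) hS
  have hS2 := congrArg (fun u => b.repr u 2) hS
  have hS3 := congrArg (fun u => b.repr u 3) hS
  simp only [map_add, Finsupp.add_apply, Basis.repr_self, Finsupp.single_apply, Fin.reduceEq,
    if_true, if_false] at hS0 hS1 hS2 hS3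
  have dxy : ¬ (b.repr x 0 = b.repr y 0 ∧ b.repr x 1 = b.repr y 1 ∧
      b.repr x 2 = b.repr y 2 ∧ b.repr x 3 = b.repr y 3) :=
    fun e => hxy (ext_four b e.1 e.2.1 e.2.2.1 e.2.2.2)
  have dxz : ¬ (b.repr x 0 = b.repr z 0 ∧ b.repr x 1 = b.repr z 1 ∧
      b.repr x 2 = b.repr z 2 ∧ b.repr x 3 = b.repr z 3) :=
    fun e => hxz (ext_four b e.1 e.2.1 e.2.2.1 e.2.2.2)
  have dyz : ¬ (b.repr y 0 = b.repr z 0 ∧ b.repr y 1 = b.repr z 1 ∧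
      b.repr y 2 = b.repr z 2 ∧ b.repr y 3 = b.repr z 3) :=
    fun e => hyz (ext_four b e.1 e.2.1 e.2.2.1 e.2.2.2)
  -- The first two coordinates of `v` are nonnegative with sum 2, so 0 and 2 must be excluded. Here
  -- `v` would be (0, 2, -1, -1), and the negative vertices would vanish at 2 and 3; the sum
  -- relation then makes `w` vanish there as well, against its level.
  have hp0 : b.repr v 0 ≠ 0 := by
    intro hp
    have key : ∀ x ∈ levelNeg V b, b.repr x 2 = 0 ∧ b.repr x 3 = 0 := fun x hx => by
      have := hneg x hx
      omega
    have := key x (by simp [hN])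
    have := key y (by simp [hN])
    have := key z (by simp [hN])
    clear dxy dxz dyz hx hy hz
    omega
  -- With `v` = (2, 0, -1, -1) the sum relation forces all the coordinates at 1 to be 0 and the
  -- coordinates at 0 to add up to -1. But at most one of the three vertices is -`b 0`, and the
  -- others have coordinate at least 1 at 0.
  have hp2 : b.repr v 0 ≠ 2 := by
    intro hp
    have key : ∀ x ∈ levelNeg V b,
        (b.repr x 0 = -1 ∧ b.repr x 1 = 0 ∧ b.repr x 2 = 0 ∧ b.repr x 3 = 0) ∨
        (0 ≤ b.repr x 0 ∧ b.repr x 1 ≤ 0 ∧ (b.repr x 0 = 0 → b.repr x 1 = -1)) := fun x hx => by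
      have := hneg x hx
      omega
    have := key x (by simp [hN])
    have := key y (by simp [hN])
    have := key z (by simp [hN])
    clear hx hy hz
    omega
  have hp1 : b.repr v 0 = 1 := by omega
  have key : ∀ x ∈ levelNeg V b, b.repr x 0 ≤ 0 ∧ -1 ≤ b.repr x 1 ∧ b.repr x 1 ≤ 0 ∧
      (b.repr x 1 = -1 → b.repr x 2 = 0 ∧ b.repr x 3 = 0 ∧ b.repr w 2 ≤ 1 ∧ b.repr w 3 ≤ 1) :=
    fun x hx => by
      have := hneg x hx
      omega
  have kx := key x (by simp [hN])
  have ky := key y (by simp [hN])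
  have kz := key z (by simp [hN])
  clear dxy dxz dyz hx hy hz
  have hw21 : b.repr w 2 = 1 := by omega
  have hw31 : b.repr w 3 = 1 := by omega
  have hx0 : b.repr x 0 = 0 ∧ b.repr y 0 = 0 ∧ b.repr z 0 = 0 := by omega
  refine ⟨hp1, hw21, fun u hu => ?_⟩
  rw [hN] at hu
  simp only [Finset.mem_insert, Finset.mem_singleton] at hu
  rcases hu with rfl | rfl | rfl
  exacts [hx0.1, hx0.2.1, hx0.2.2]

/-- The case of nine vertices with nonzero sum. -/
lemma IsNeighborlyFano.classification_nine_of_sum_eq (hV : IsNeighborlyFano V)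
    (hc : V.card = 9) (h : IsTwoLevelZero V b v w) (hν : ∑ x ∈ V, x = b 0) :
    ∃ g : Basis (Fin 4) ℤ (Fin 4 → ℤ), ∀ x, x ∈ V ↔
      (∃ i, x = g i ∨ x = -g i) ∨ x = ∑ i, g i := by
  classical
  obtain ⟨hp1, hw21, hx0⟩ := hV.coords_of_sum_eq hc h hν
  have hneg := hV.levelNeg_coords_of_sum_eq hc h hν
  have hv0 := h.left_zero_nonneg
  have hv1 := h.left_one_nonneg
  have hv2 := h.left_two
  have hv3 := h.left_three
  have hw0 := h.right_zero
  have hw1 := h.right_one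
  have hw2 := h.right_two_nonneg
  have hw3 := h.right_three_nonneg
  have hvl := h.level_left
  have hwl := h.level_right
  rw [level_four] at hvl hwl
  have hw31 : b.repr w 3 = 1 := by omega
  have hL := hV.levelZero_eq h
  have hcard := h.facet.card_eq
  rw [hL, Finset.card_pair h.ne] at hcard
  have hN' : levelNeg V b = {-b 1, -b 2, -b 3} := by
    refine Finset.eq_of_subset_of_card_le (fun u hu => ?_) ?_
    · have hu0 := hx0 u hu
      have h1 := hneg u hu
      obtain ⟨i, rfl⟩ := exists_eq_neg_of_nonpos (level_four b u ▸ h1.1) hu0.le h1.2.2.1.1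
        h1.2.2.1.2.1 h1.2.2.1.2.2
      fin_cases i
      · simp at hu0
      all_goals simp
    · have h3 : (levelNeg V b).card = 3 := by omega
      rw [h3]
      exact Finset.card_le_three
  have hvw : v = -w := by
    apply ext_four b <;> simp only [map_neg, Finsupp.neg_apply] <;> omega
  obtain ⟨-, b', hb', h0', hj', -, -, -⟩ := hV.level_zero_coord h.facet h.mem_right h.level_right
    (hw0.trans_lt (by norm_num))
  have e1 := hj' 1 (by decide)
  have e2 := hj' 2 (by decide)
  have e3 := hj' 3 (by decide)
  -- The vertex without an opposite is `b 0`, so the basis must consist of the four opposite pairs: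
  -- `b 0` is traded for `w` = (-1, -1, 1, 1), and `b 0` = -`w` - `b 1` + `b 2` + `b 3`.
  have hsum : ∑ i, b'.unitsSMul ![-1, -1, 1, 1] i = b 0 := by
    apply ext_four b <;>
      simp [Fin.sum_univ_four, Basis.unitsSMul_apply, h0', e1, e2, e3, hw0, hw1, hw21, hw31]
  refine ⟨b'.unitsSMul ![-1, -1, 1, 1], fun x => ?_⟩
  rw [exists_eq_unitsSMul_or_neg, hsum, h.facet.mem_iff, hL, hN', hvw]
  have hr : x ∈ Set.range b ↔ x = b 0 ∨ x = b 1 ∨ x = b 2 ∨ x = b 3 := by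
    simp [Fin.exists_fin_succ, eq_comm]
  have hr' : (∃ i, x = b' i ∨ x = -b' i) ↔ (x = w ∨ x = -w) ∨ (x = b 1 ∨ x = -b 1) ∨
      (x = b 2 ∨ x = -b 2) ∨ x = b 3 ∨ x = -b 3 := by
    rw [← h0', ← e1, ← e2, ← e3]
    simp [Fin.exists_fin_succ]
  rw [hr, hr']
  simp only [Finset.mem_insert, Finset.mem_singleton]
  refine iff_of_eq ?_
  ac_rfl

end Classification

/-! ### Nine vertices with sum zero are impossible -/

section NineZero

variable {V : Finset (Fin 4 → ℤ)} {b : Basis (Fin 4) ℤ (Fin 4 → ℤ)} {u v w x y z : Fin 4 → ℤ}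

lemma IsNeighborlyFano.neg_two_le_neighbor_level (hV : IsNeighborlyFano V) (hc : V.card = 9)
    (hν : ∑ x ∈ V, x = 0) (hb : IsFacetBasis V b) (hu : u ∈ V) (h0 : level b u = 0) {i : Fin 4}
    (hi : b.repr u i = -1) (hx : x ∈ V) : -2 ≤ level b x - b.repr x i := by
  obtain ⟨-, b', hb', -, -, -, -, h6⟩ := hV.level_zero_coord hb hu h0 (hi.trans_lt (by norm_num))
  have h7 := hb'.le_level hx
  have h8 := hV.card_levelZero_le hb'
  rw [hν, level_zero] at h7
  rw [← h6 x]
  omega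

lemma IsNeighborlyFano.neg_three_le_neighbor_level (hV : IsNeighborlyFano V) (hc : V.card = 9)
    (hν : ∑ x ∈ V, x = 0) (hb : IsFacetBasis V b) (hu : u ∈ V) (h0 : level b u = 0) {i : Fin 4}
    (hi : b.repr u i = -1) (hx : x ∈ V) (hy : y ∈ V) (hxy : x ≠ y)
    (hx0 : level b x - b.repr x i < 0) (hy0 : level b y - b.repr y i < 0) :
    -3 ≤ (level b x - b.repr x i) + (level b y - b.repr y i) := by
  obtain ⟨-, b', hb', -, -, -, -, h6⟩ := hV.level_zero_coord hb hu h0 (hi.trans_lt (by norm_num))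
  rw [← h6] at hx0 hy0 ⊢
  rw [← h6]
  have h7 := hV.le_level_add_level hb' hx hy hxy hx0 hy0
  rw [hν, level_zero] at h7
  omega

/-- A vertex of level zero with respect to an adjacent facet has two negative coordinates there. -/
lemma IsNeighborlyFano.exists_neighbor_repr_neg (hV : IsNeighborlyFano V)
    (hb : IsFacetBasis V b) (hu : u ∈ V) (h0 : level b u = 0) {i : Fin 4}
    (hi : b.repr u i = -1) (hx : x ∈ V) (hx1 : level b x = -1) (hxi : b.repr x i = -1)
    (j : Fin 4) : ∃ k, k ≠ i ∧ k ≠ j ∧ b.repr x k < b.repr u k := by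
  obtain ⟨-, b', hb', -, -, h4, h5, h6⟩ := hV.level_zero_coord hb hu h0 (hi.trans_lt (by norm_num))
  by_contra! hk
  have h7 := h6 x
  have h8 : x = -b' j := hV.eq_neg_of_nonneg hb' hx (by omega) j fun k hkj => by
    by_cases hki : k = i
    · rw [hki, h4 x, hxi]; norm_num
    · rw [h5 x k hki, hxi]
      have := hk k hki hkj
      omega
  have h9 := congrArg (level b') h8
  rw [level_neg, level_self] at h9
  omega

/-- A facet with vertices `v`, `w` at level `0`, vertices `x`, `y` at level `-1`, and a vertex `z` at
level `-2`. -/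
structure IsDeep (V : Finset (Fin 4 → ℤ)) (b : Basis (Fin 4) ℤ (Fin 4 → ℤ))
    (v w x y z : Fin 4 → ℤ) : Prop where
  two : IsTwoLevelZero V b v w
  hx : x ∈ V
  hy : y ∈ V
  hz : z ∈ V
  lx : level b x = -1
  ly : level b y = -1
  lz : level b z = -2
  hxy : x ≠ y
  sum_eq : ∑ i, b i + (v + w) + (x + y + z) = 0

lemma IsDeep.symm (h : IsDeep V b v w x y z) : IsDeep V b v w y x z :=
  ⟨h.two, h.hy, h.hx, h.hz, h.ly, h.lx, h.lz, h.hxy.symm, by rw [add_comm y x]; exact h.sum_eq⟩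

lemma IsDeep.reindex {σ : Equiv.Perm (Fin 4)} (h : IsDeep V b v w x y z)
    (h2 : IsTwoLevelZero V (b.reindex σ) v w) : IsDeep V (b.reindex σ) v w x y z := by
  refine ⟨h2, h.hx, h.hy, h.hz, ?_, ?_, ?_, h.hxy, ?_⟩
  · rw [level_reindex, h.lx]
  · rw [level_reindex, h.ly]
  · rw [level_reindex, h.lz]
  · rw [← h.sum_eq, ← Equiv.sum_comp σ.symm b]
    simp

lemma IsDeep.reindex' {σ : Equiv.Perm (Fin 4)} (h : IsDeep V b v w x y z)
    (h2 : IsTwoLevelZero V (b.reindex σ) w v) : IsDeep V (b.reindex σ) w v x y z := by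
  refine ⟨h2, h.hx, h.hy, h.hz, ?_, ?_, ?_, h.hxy, ?_⟩
  · rw [level_reindex, h.lx]
  · rw [level_reindex, h.ly]
  · rw [level_reindex, h.lz]
  · rw [← h.sum_eq, ← Equiv.sum_comp σ.symm b, add_comm v w]
    simp

lemma IsDeep.sum_repr (h : IsDeep V b v w x y z) (i : Fin 4) :
    1 + (b.repr v i + b.repr w i) + (b.repr x i + b.repr y i + b.repr z i) = 0 := by
  have := congrArg (fun u => b.repr u i) h.sum_eq
  simpa [Finsupp.single_apply] using this

lemma IsDeep.ne_of_level (h : IsDeep V b v w x y z) : v ≠ z ∧ w ≠ z ∧ x ≠ z ∧ y ≠ z := by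
  have h1 := h.two.level_left
  have h2 := h.two.level_right
  have h3 := h.lx
  have h4 := h.ly
  have h5 := h.lz
  refine ⟨?_, ?_, ?_, ?_⟩ <;> rintro rfl <;> omega

/-- A positive coordinate would push `z` to level -3 or lower on an adjacent facet, while -2 is the
minimum when the vertex sum is 0. -/
lemma IsDeep.repr_nonpos (h : IsDeep V b v w x y z) (hV : IsNeighborlyFano V) (hc : V.card = 9)
    (hν : ∑ x ∈ V, x = 0) :
    b.repr z 0 ≤ 0 ∧ b.repr z 1 ≤ 0 ∧ b.repr z 2 ≤ 0 ∧ b.repr z 3 ≤ 0 := by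
  have h2 := h.two
  have lz := h.lz
  have c0 := hV.neg_two_le_neighbor_level hc hν h2.facet h2.mem_right h2.level_right h2.right_zero h.hz
  have c1 := hV.neg_two_le_neighbor_level hc hν h2.facet h2.mem_right h2.level_right h2.right_one h.hz
  have c2 := hV.neg_two_le_neighbor_level hc hν h2.facet h2.mem_left h2.level_left h2.left_two h.hz
  have c3 := hV.neg_two_le_neighbor_level hc hν h2.facet h2.mem_left h2.level_left h2.left_three h.hz
  omega

/-- If `z` keeps level `-2` with respect to an adjacent facet, then the other vertices are at level
at least `-1` there. -/
lemma IsDeep.neighbor_level (h : IsDeep V b v w x y z) (hV : IsNeighborlyFano V) (hc : V.card = 9)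
    (hν : ∑ x ∈ V, x = 0) (hu : u ∈ V) (hu0 : level b u = 0) {i : Fin 4} (hi : b.repr u i = -1)
    (hzi : b.repr z i = 0) :
    b.repr v i ≤ 1 ∧ b.repr w i ≤ 1 ∧ b.repr x i ≤ 0 ∧ b.repr y i ≤ 0 := by
  have lv := h.two.level_left
  have lw := h.two.level_right
  have lx := h.lx
  have ly := h.ly
  have lz := h.lz
  obtain ⟨nv, nw, nx, ny⟩ := h.ne_of_level
  have key := fun t ht hn h1 => hV.neg_three_le_neighbor_level hc hν h.two.facet hu hu0 hi (x := t)
    (y := z) ht h.hz hn h1 (by omega)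
  refine ⟨?_, ?_, ?_, ?_⟩ <;> by_contra! hlt
  · have := key v h.two.mem_left nv (by omega)
    omega
  · have := key w h.two.mem_right nw (by omega)
    omega
  · have := key x h.hx nx (by omega)
    omega
  · have := key y h.hy ny (by omega)
    omega

lemma IsDeep.neg_one_le (h : IsDeep V b v w x y z) (hV : IsNeighborlyFano V) (i : Fin 4) :
    -1 ≤ b.repr x i :=
  hV.neg_one_le_repr h.two.facet h.hx h.lx.ge (by rw [h.lx]; norm_num) i

/-- The constraints determine all the vertices: `v` = (1, 1, -1, -1), `w` = (-1, -1, 1, 1), `x` =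
-`b 2`, `y` = -`b 3`. Then `z + b 2 = w + y` contradicts `eq_or_eq_of_add_eq_add`. -/
lemma IsDeep.false_of_zero_one_two (h : IsDeep V b v w x y z) (hV : IsNeighborlyFano V)
    (hc : V.card = 9) (hν : ∑ x ∈ V, x = 0) (hz0 : b.repr z 0 = -1) (hz1 : b.repr z 1 = -1)
    (hz2 : b.repr z 2 = 0) (hz3 : b.repr z 3 = 0) (hx2 : b.repr x 2 = -1) : False := by
  have h2 := h.two
  have a2 := h.neighbor_level hV hc hν h2.mem_left h2.level_left h2.left_two hz2
  have a3 := h.neighbor_level hV hc hν h2.mem_left h2.level_left h2.left_three hz3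
  have lv := h2.level_left
  have lw := h2.level_right
  have lx := h.lx
  rw [level_four] at lv lw lx
  obtain ⟨hF, hv, hw, -, -, v2, v3, w0, w1, v0, v1, w2, w3⟩ := h2
  have x3 := h.neg_one_le hV 3
  have y0 := h.symm.neg_one_le hV 0
  have y1 := h.symm.neg_one_le hV 1
  have s0 := h.sum_repr 0
  have s1 := h.sum_repr 1
  have s2 := h.sum_repr 2
  have s3 := h.sum_repr 3
  have n0 := hV.neg_one_le_neighbor_repr hF hv h.two.level_left v2 h.hx
    (by rw [h.lx, hx2]) (by rw [h.lx, hx2]; norm_num) (j := 0) (by decide)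
  have n1 := hV.neg_one_le_neighbor_repr hF hv h.two.level_left v2 h.hx
    (by rw [h.lx, hx2]) (by rw [h.lx, hx2]; norm_num) (j := 1) (by decide)
  rw [hx2] at n0 n1
  have m0 : b.repr x 0 < b.repr v 0 := by
    obtain ⟨k, hk, hk', hlt⟩ := hV.exists_neighbor_repr_neg hF hv h.two.level_left v2 h.hx h.lx hx2 1
    fin_cases k <;> simp at hk hk' hlt <;> omega
  have m1 : b.repr x 1 < b.repr v 1 := by
    obtain ⟨k, hk, hk', hlt⟩ := hV.exists_neighbor_repr_neg hF hv h.two.level_left v2 h.hx h.lx hx2 0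
    fin_cases k <;> simp at hk hk' hlt <;> omega
  have e : z + b 2 = w + y := by
    apply ext_four b <;>
      simp only [map_add, Finsupp.add_apply, Basis.repr_self, Finsupp.single_apply, Fin.reduceEq,
        if_true, if_false] <;> omega
  have hz2' : z ≠ b 2 := by
    rintro rfl
    simp at hz2
  rcases hV.eq_or_eq_of_add_eq_add h.hz (hF.mem 2) hw h.hy hz2' (fun h0 => by
      have := congrArg (fun u => b.repr u 0) h0
      simp [hz0] at this) e with h1 | h1
  · exact h.ne_of_level.2.1 h1
  · rw [h1] at w0
    simp at w0

lemma IsDeep.false_of_zero_one (h : IsDeep V b v w x y z) (hV : IsNeighborlyFano V)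
    (hc : V.card = 9) (hν : ∑ x ∈ V, x = 0) (hz0 : b.repr z 0 = -1) (hz1 : b.repr z 1 = -1)
    (hz2 : b.repr z 2 = 0) (hz3 : b.repr z 3 = 0) : False := by
  have h2 := h.two
  have a2 := h.neighbor_level hV hc hν h2.mem_left h2.level_left h2.left_two hz2
  have a3 := h.neighbor_level hV hc hν h2.mem_left h2.level_left h2.left_three hz3
  have lw := h2.level_right
  rw [level_four, h2.right_zero, h2.right_one] at lw
  have s2 := h.sum_repr 2
  have v2 := h2.left_two
  by_cases hx2 : b.repr x 2 = -1
  · exact h.false_of_zero_one_two hV hc hν hz0 hz1 hz2 hz3 hx2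
  · exact h.symm.false_of_zero_one_two hV hc hν hz0 hz1 hz2 hz3 (by omega)

lemma IsDeep.false_of_zero_two_three (h : IsDeep V b v w x y z) (hV : IsNeighborlyFano V)
    (hc : V.card = 9) (hν : ∑ x ∈ V, x = 0) (hz0 : b.repr z 0 = -1) (hz1 : b.repr z 1 = 0)
    (hz2 : b.repr z 2 = -1) (hw2 : b.repr w 2 = 1)
    (hx3 : b.repr x 3 = -1) : False := by
  have h2 := h.two
  have a1 := h.neighbor_level hV hc hν h2.mem_right h2.level_right h2.right_one hz1
  have lv := h2.level_left
  have lx := h.lx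
  rw [level_four] at lv lx
  obtain ⟨hF, hv, hw, -, -, v2, v3, w0, w1, v0, v1, -, -⟩ := h2
  have x2 := h.neg_one_le hV 2
  have y0 := h.symm.neg_one_le hV 0
  have s0 := h.sum_repr 0
  have s1 := h.sum_repr 1
  have n0 := hV.neg_one_le_neighbor_repr hF hv h.two.level_left v3 h.hx
    (by rw [h.lx, hx3]) (by rw [h.lx, hx3]; norm_num) (j := 0) (by decide)
  rw [hx3] at n0
  -- On the facet with `w` in place of `b 0`, the vertex `z` has level -1 and its coordinate at 2 is
  -- -2.
  have n := hV.neg_one_le_neighbor_repr hF hw h.two.level_right w0 h.hz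
    (by rw [h.lz, hz0]; norm_num) (by rw [h.lz, hz0]; norm_num) (j := 2) (by decide)
  rw [hz2, hz0, hw2] at n
  norm_num at n

lemma IsDeep.false_of_zero_two_one (h : IsDeep V b v w x y z) (hV : IsNeighborlyFano V)
    (hc : V.card = 9) (hν : ∑ x ∈ V, x = 0) (hz3 : b.repr z 3 = 0) (hw3 : b.repr w 3 = 0)
    (hx1 : b.repr x 1 = -1) : False := by
  have h2 := h.two
  have a3 := h.neighbor_level hV hc hν h2.mem_left h2.level_left h2.left_three hz3
  obtain ⟨hF, hv, hw, -, -, v2, v3, w0, w1, v0, v1, -, -⟩ := h2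
  have x0 := h.neg_one_le hV 0
  have s3 := h.sum_repr 3
  -- Only `k` = 0 and `k` = 3 remain: `x` is at least -1 = `w` at 0, and both `x` and `w` vanish at
  -- 3.
  obtain ⟨k, hk, hk', hlt⟩ := hV.exists_neighbor_repr_neg hF hw h.two.level_right w1 h.hx h.lx hx1 2
  fin_cases k <;> simp at hk hk' hlt <;> omega

lemma IsDeep.false_of_zero_two (h : IsDeep V b v w x y z) (hV : IsNeighborlyFano V)
    (hc : V.card = 9) (hν : ∑ x ∈ V, x = 0) (hz0 : b.repr z 0 = -1) (hz1 : b.repr z 1 = 0)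
    (hz2 : b.repr z 2 = -1) (hz3 : b.repr z 3 = 0) : False := by
  have h2 := h.two
  have a1 := h.neighbor_level hV hc hν h2.mem_right h2.level_right h2.right_one hz1
  have a3 := h.neighbor_level hV hc hν h2.mem_left h2.level_left h2.left_three hz3
  have lv := h2.level_left
  have lw := h2.level_right
  rw [level_four] at lv lw
  obtain ⟨hF, hv, hw, -, -, v2, v3, w0, w1, v0, v1, w2, w3⟩ := h2
  have s0 := h.sum_repr 0
  have s1 := h.sum_repr 1
  have s2 := h.sum_repr 2
  have s3 := h.sum_repr 3
  by_cases hw2 : b.repr w 2 = 1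
  · by_cases hx3 : b.repr x 3 = -1
    · exact h.false_of_zero_two_three hV hc hν hz0 hz1 hz2 hw2 hx3
    · exact h.symm.false_of_zero_two_three hV hc hν hz0 hz1 hz2 hw2 (by omega)
  · have hw3 : b.repr w 3 = 0 := by omega
    by_cases hx1 : b.repr x 1 = -1
    · exact h.false_of_zero_two_one hV hc hν hz3 hw3 hx1
    by_cases hy1 : b.repr y 1 = -1
    · exact h.symm.false_of_zero_two_one hV hc hν hz3 hw3 hy1
    -- Neither `x` nor `y` is negative at 1, which forces `v` = (2, 0, -1, -1); the sum relation
    -- then gives this equality coordinate by coordinate.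
    have e : x + y = z := by
      apply ext_four b <;> simp only [map_add, Finsupp.add_apply] <;> omega
    refine hV.add_notMem h.hx h.hy h.hxy (fun h0 => ?_) (e ▸ h.hz)
    rw [← e, h0] at hz0
    simp at hz0

lemma IsDeep.false (h : IsDeep V b v w x y z) (hV : IsNeighborlyFano V)
    (hc : V.card = 9) (hν : ∑ x ∈ V, x = 0) : False := by
  have hn := h.repr_nonpos hV hc hν
  have lz := h.lz
  have hF := h.two.facet
  have key : ∀ i, ¬ ∀ j, j ≠ i → 0 ≤ b.repr z j := fun i hi => by
    have h1 := hV.eq_neg_of_nonneg hF h.hz (by omega) i hi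
    rw [h1, level_neg, level_self] at lz
    omega
  rw [level_four] at lz
  have k0 : b.repr z 0 ≠ -2 := fun h0 => key 0 fun j hj => by
    fin_cases j <;> simp at hj ⊢ <;> omega
  have k1 : b.repr z 1 ≠ -2 := fun h0 => key 1 fun j hj => by
    fin_cases j <;> simp at hj ⊢ <;> omega
  have k2 : b.repr z 2 ≠ -2 := fun h0 => key 2 fun j hj => by
    fin_cases j <;> simp at hj ⊢ <;> omega
  have k3 : b.repr z 3 ≠ -2 := fun h0 => key 3 fun j hj => by
    fin_cases j <;> simp at hj ⊢ <;> omega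
  -- No coordinate is -2, since `z` would have a single negative coordinate; so `z` is the negative
  -- of a sum of two distinct basis vectors.
  have hcase :
      (b.repr z 0 = -1 ∧ b.repr z 1 = -1 ∧ b.repr z 2 = 0 ∧ b.repr z 3 = 0) ∨
      (b.repr z 0 = -1 ∧ b.repr z 1 = 0 ∧ b.repr z 2 = -1 ∧ b.repr z 3 = 0) ∨
      (b.repr z 0 = -1 ∧ b.repr z 1 = 0 ∧ b.repr z 2 = 0 ∧ b.repr z 3 = -1) ∨
      (b.repr z 0 = 0 ∧ b.repr z 1 = -1 ∧ b.repr z 2 = -1 ∧ b.repr z 3 = 0) ∨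
      (b.repr z 0 = 0 ∧ b.repr z 1 = -1 ∧ b.repr z 2 = 0 ∧ b.repr z 3 = -1) ∨
      (b.repr z 0 = 0 ∧ b.repr z 1 = 0 ∧ b.repr z 2 = -1 ∧ b.repr z 3 = -1) := by
    clear key
    have m0 : -1 ≤ b.repr z 0 := by omega
    have m1 : -1 ≤ b.repr z 1 := by omega
    have m2 : -1 ≤ b.repr z 2 := by omega
    have m3 : -1 ≤ b.repr z 3 := by omega
    clear k0 k1 k2 k3
    by_cases c0 : b.repr z 0 = -1
    · by_cases c1 : b.repr z 1 = -1
      · exact Or.inl ⟨c0, c1, by omega, by omega⟩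
      by_cases c2 : b.repr z 2 = -1
      · exact Or.inr (Or.inl ⟨c0, by omega, c2, by omega⟩)
      · exact Or.inr (Or.inr (Or.inl ⟨c0, by omega, by omega, by omega⟩))
    by_cases c1 : b.repr z 1 = -1
    · by_cases c2 : b.repr z 2 = -1
      · exact Or.inr (Or.inr (Or.inr (Or.inl ⟨by omega, c1, c2, by omega⟩)))
      · exact Or.inr (Or.inr (Or.inr (Or.inr (Or.inl ⟨by omega, c1, by omega, by omega⟩))))
    · exact Or.inr (Or.inr (Or.inr (Or.inr (Or.inr ⟨by omega, by omega, by omega, by omega⟩))))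
  have hl := h.reindex h.two.reindex_swap_left
  have hr := h.reindex h.two.reindex_swap_right
  have hlr := hl.reindex hl.two.reindex_swap_right
  have ha := h.reindex' h.two.reindex_add_two
  have r1 := h.false_of_zero_one hV hc hν
  have r2 := h.false_of_zero_two hV hc hν
  have r3 := ha.false_of_zero_one hV hc hν
  have r4 := hl.false_of_zero_two hV hc hν
  have r5 := hr.false_of_zero_two hV hc hν
  have r6 := hlr.false_of_zero_two hV hc hν
  have l0 : (Equiv.swap (0 : Fin 4) 1) 0 = 1 := rfl
  have l1 : (Equiv.swap (0 : Fin 4) 1) 1 = 0 := rfl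
  have l2 : (Equiv.swap (0 : Fin 4) 1) 2 = 2 := rfl
  have l3 : (Equiv.swap (0 : Fin 4) 1) 3 = 3 := rfl
  have e0 : (Equiv.swap (2 : Fin 4) 3) 0 = 0 := rfl
  have e1 : (Equiv.swap (2 : Fin 4) 3) 1 = 1 := rfl
  have e2 : (Equiv.swap (2 : Fin 4) 3) 2 = 3 := rfl
  have e3 : (Equiv.swap (2 : Fin 4) 3) 3 = 2 := rfl
  have a0 : (Equiv.addRight (2 : Fin 4)).symm 0 = 2 := rfl
  have a1 : (Equiv.addRight (2 : Fin 4)).symm 1 = 3 := rfl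
  have a2 : (Equiv.addRight (2 : Fin 4)).symm 2 = 0 := rfl
  have a3 : (Equiv.addRight (2 : Fin 4)).symm 3 = 1 := rfl
  simp only [Basis.repr_reindex_apply, Equiv.symm_swap, l0, l1, l2, l3, e0, e1, e2, e3, a0, a1,
    a2, a3] at r3 r4 r5 r6
  rcases hcase with ⟨c0, c1, c2, c3⟩ | ⟨c0, c1, c2, c3⟩ | ⟨c0, c1, c2, c3⟩ | ⟨c0, c1, c2, c3⟩ |
    ⟨c0, c1, c2, c3⟩ | ⟨c0, c1, c2, c3⟩
  exacts [r1 c0 c1 c2 c3, r2 c0 c1 c2 c3, r5 c0 c1 c3 c2, r4 c1 c0 c2 c3, r6 c1 c0 c3 c2,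
    r3 c2 c3 c0 c1]

/-- Counting leaves one or two. With two, the three remaining negative levels add up to -4, so they
are -1, -1, -2, which is the configuration `IsDeep`. -/
lemma IsNeighborlyFano.card_levelZero_eq_one (hV : IsNeighborlyFano V) (hc : V.card = 9)
    (hν : ∑ x ∈ V, x = 0) (hb : IsFacetBasis V b) : (levelZero V b).card = 1 := by
  classical
  have h1 := hb.level_sum_add_card_le
  have h2 := hV.card_levelZero_le hb
  rw [hν, level_zero] at h1
  by_contra h3
  obtain ⟨σ, v, w, -, h⟩ := hV.exists_isTwoLevelZero hb (by omega) 0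
  generalize b.reindex σ.symm = b at h
  have hL := hV.levelZero_eq h
  have hcard := h.facet.card_eq
  rw [hL, Finset.card_pair h.ne] at hcard
  obtain ⟨x, y, z, hxy, hxz, hyz, hN⟩ := Finset.card_eq_three.1 (show (levelNeg V b).card = 3 by
    omega)
  have hS := h.facet.sum_eq fun x => x
  have hl := h.facet.level_sum_eq
  rw [hν, hL, hN, Finset.sum_pair h.ne, Finset.sum_insert (by simp [hxy, hxz]),
    Finset.sum_pair hyz] at hS
  rw [hν, level_zero, hN, Finset.sum_insert (by simp [hxy, hxz]), Finset.sum_pair hyz] at hl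
  obtain ⟨hx, lx⟩ := mem_levelNeg.1 (show x ∈ levelNeg V b by simp [hN])
  obtain ⟨hy, ly⟩ := mem_levelNeg.1 (show y ∈ levelNeg V b by simp [hN])
  obtain ⟨hz, lz⟩ := mem_levelNeg.1 (show z ∈ levelNeg V b by simp [hN])
  by_cases c1 : level b z = -2
  · exact IsDeep.false ⟨h, hx, hy, hz, by omega, by omega, c1, hxy,
      by rw [hS]; abel⟩ hV hc hν
  by_cases c2 : level b y = -2
  · exact IsDeep.false ⟨h, hx, hz, hy, by omega, by omega, c2, hxz, by rw [hS]; abel⟩ hV hc hν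
  · exact IsDeep.false ⟨h, hy, hz, hx, by omega, by omega, by omega, hyz, by rw [hS]; abel⟩ hV hc hν

/-- If the sum were 0, every facet would have one level-zero vertex and four vertices at level -1.
The latter vanish at the two or more negative coordinates of the level-zero vertex, so only -`b 0`
and -`b 1` are left for them. -/
lemma IsNeighborlyFano.sum_ne_zero (hV : IsNeighborlyFano V) (hc : V.card = 9) :
    ∑ x ∈ V, x ≠ 0 := by
  classical
  intro hν
  obtain ⟨b₀, hb₀, -⟩ := hV.exists_cone 0
  obtain ⟨v, hL⟩ := Finset.card_eq_one.1 (hV.card_levelZero_eq_one hc hν hb₀)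
  obtain ⟨hv, hv0⟩ := mem_levelZero.1 (show v ∈ levelZero V b₀ by simp [hL])
  obtain ⟨s, hs, t, ht, hst⟩ := Finset.one_lt_card.1 (hV.two_le_card_negCoords hb₀ hv hv0)
  have hT : ∃ i, i ∈ ({s, t} : Finset (Fin 4))ᶜ := by
    rw [← Finset.Nonempty, ← Finset.card_pos, Finset.card_compl, Finset.card_pair hst,
      Fintype.card_fin]
    norm_num
  obtain ⟨i, hi⟩ := hT
  obtain ⟨σ, -, -, hσ2, hσ3⟩ := exists_perm_of_disjoint (S := {s, t}) (T := {s, t}ᶜ)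
    (by rw [Finset.card_pair hst])
    (by rw [Finset.card_compl, Finset.card_pair hst, Fintype.card_fin])
    disjoint_compl_right hi
  have hsub : ∀ j ∈ ({s, t} : Finset (Fin 4)), b₀.repr v j < 0 := fun j hj => by
    rcases Finset.mem_insert.1 hj with rfl | hj
    · exact mem_negCoords.1 hs
    · rw [Finset.mem_singleton.1 hj]
      exact mem_negCoords.1 ht
  have hb := hb₀.reindex σ.symm
  have h2 : (b₀.reindex σ.symm).repr v 2 < 0 := by simpa using hsub _ hσ2
  have h3 : (b₀.reindex σ.symm).repr v 3 < 0 := by simpa using hsub _ hσ3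
  have hv0 : level (b₀.reindex σ.symm) v = 0 := by rw [level_reindex, hv0]
  generalize b₀.reindex σ.symm = b at hb h2 h3 hv0
  clear hL hb₀ hsub hσ2 hσ3
  have hlev : ∀ b, IsFacetBasis V b → ∀ x ∈ V, -1 ≤ level b x := fun b hb x hx => by
    have h3 := hb.le_level hx
    rw [hν, level_zero, hV.card_levelZero_eq_one hc hν hb, hc] at h3
    omega
  have hzero : ∀ x ∈ V, level b x = -1 → ∀ i, b.repr v i < 0 → b.repr x i = 0 := by
    intro x hx hx1 i hi
    obtain ⟨-, b', hb', -, -, -, -, h6⟩ := hV.level_zero_coord hb hv hv0 hi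
    have h7 := hlev b' hb' x hx
    have h8 := hV.neg_one_le_repr hb hx hx1.ge (by omega) i
    have h9 := h6 x
    -- A coordinate -1 would put `x` at level 0 on the adjacent facet `b'`, where the abandoned
    -- vertex `b i` is already at level 0.
    by_contra hne
    have h10 := h6 (b i)
    rw [level_self, Basis.repr_self, Finsupp.single_eq_same] at h10
    have h11 := Finset.card_le_one.1 (hV.card_levelZero_eq_one hc hν hb').le x
      (mem_levelZero.2 ⟨hx, by omega⟩) (b i) (mem_levelZero.2 ⟨hb.mem i, by omega⟩)
    rw [h11, level_self] at hx1
    omega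
  have hN : levelNeg V b ⊆ {-b 0, -b 1} := by
    intro x hx
    obtain ⟨hx, hx0⟩ := mem_levelNeg.1 hx
    have hx1 : level b x = -1 := by
      have := hlev b hb x hx
      omega
    have x2 := hzero x hx hx1 2 h2
    have x3 := hzero x hx hx1 3 h3
    have y0 := hV.neg_one_le_repr hb hx hx1.ge hx0.le 0
    have y1 := hV.neg_one_le_repr hb hx hx1.ge hx0.le 1
    obtain ⟨i, rfl⟩ := exists_eq_neg_of_nonpos hx1 (by rw [level_four] at hx1; omega)
      (by rw [level_four] at hx1; omega) x2.le x3.le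
    fin_cases i
    · simp
    · simp
    · simp at x2
    · simp at x3
  have h4 := (Finset.card_le_card hN).trans Finset.card_le_two
  have h5 := hb.card_eq
  have h6 := hV.card_levelZero_eq_one hc hν hb
  omega

/-- The classification of the neighborly Fano vertex sets with nine elements. -/
lemma IsNeighborlyFano.classification_nine (hV : IsNeighborlyFano V) (hc : V.card = 9) :
    ∃ g : Basis (Fin 4) ℤ (Fin 4 → ℤ), ∀ x, x ∈ V ↔
      (∃ i, x = g i ∨ x = -g i) ∨ x = ∑ i, g i := by
  obtain ⟨b, hb, hs⟩ := hV.exists_cone (∑ x ∈ V, x)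
  have h1 := hb.level_sum_add_card_le
  have h2 := hV.card_levelZero_le hb
  have h3 : ∃ i, ∑ x ∈ V, x = b i := by
    have s0 := hs 0
    have s1 := hs 1
    have s2 := hs 2
    have s3 := hs 3
    rw [level_four] at h1
    by_cases c0 : b.repr (∑ x ∈ V, x) 0 = 1
    · exact ⟨0, by apply ext_four b <;> simp only [Basis.repr_self, Finsupp.single_apply,
        Fin.reduceEq, if_true, if_false] <;> omega⟩
    by_cases c1 : b.repr (∑ x ∈ V, x) 1 = 1
    · exact ⟨1, by apply ext_four b <;> simp only [Basis.repr_self, Finsupp.single_apply,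
        Fin.reduceEq, if_true, if_false] <;> omega⟩
    by_cases c2 : b.repr (∑ x ∈ V, x) 2 = 1
    · exact ⟨2, by apply ext_four b <;> simp only [Basis.repr_self, Finsupp.single_apply,
        Fin.reduceEq, if_true, if_false] <;> omega⟩
    by_cases c3 : b.repr (∑ x ∈ V, x) 3 = 1
    · exact ⟨3, by apply ext_four b <;> simp only [Basis.repr_self, Finsupp.single_apply,
        Fin.reduceEq, if_true, if_false] <;> omega⟩
    · refine absurd ?_ (hV.sum_ne_zero hc)
      apply ext_four b <;> simp only [map_zero, Finsupp.zero_apply] <;> omega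
  obtain ⟨i, hi⟩ := h3
  rw [hi, level_self] at h1
  obtain ⟨σ, v, w, hσ, h⟩ := hV.exists_isTwoLevelZero hb (by omega) i
  refine hV.classification_nine_of_sum_eq hc h ?_
  rw [hi, Basis.reindex_apply, Equiv.symm_symm, hσ]

end NineZero

/-! ### From Fano polyhedra to neighborly vertex sets, through the polar dual -/

section Geometry

variable {d : ℕ} {P : Set (Fin d → ℝ)} {V : Finset (Fin d → ℤ)}

/-- The real vector with the given integral coordinates. -/
def castVec (z : Fin d → ℤ) : Fin d → ℝ := fun i => (z i : ℝ)

lemma castVec_injective : Function.Injective (castVec (d := d)) := fun _ _ h =>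
  funext fun i => Int.cast_injective (congrFun h i)

lemma castVec_add (x y : Fin d → ℤ) : castVec (x + y) = castVec x + castVec y := by
  ext i; simp [castVec]

lemma castVec_zsmul (n : ℤ) (x : Fin d → ℤ) : castVec (n • x) = (n : ℝ) • castVec x := by
  ext i; simp [castVec]

lemma castVec_neg (x : Fin d → ℤ) : castVec (-x) = -castVec x := by
  ext i; simp [castVec]

lemma castVec_zero : castVec (0 : Fin d → ℤ) = 0 := by
  ext i; simp [castVec]

lemma castVec_sum {ι : Type*} (s : Finset ι) (f : ι → Fin d → ℤ) :
    castVec (∑ i ∈ s, f i) = ∑ i ∈ s, castVec (f i) := by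
  ext i; simp [castVec]

lemma castVec_eq_sum (b : Basis (Fin d) ℤ (Fin d → ℤ)) (x : Fin d → ℤ) :
    castVec x = ∑ i, (b.repr x i : ℝ) • castVec (b i) := by
  conv_lhs => rw [← b.sum_repr x, castVec_sum]
  exact Finset.sum_congr rfl fun i _ => castVec_zsmul _ _

/-- The real extension of an integral linear form. -/
noncomputable def realExt (g : (Fin d → ℤ) →ₗ[ℤ] ℤ) : StrongDual ℝ (Fin d → ℝ) :=
  ∑ k, (g (Pi.single k 1) : ℝ) • ContinuousLinearMap.proj k

lemma realExt_castVec (g : (Fin d → ℤ) →ₗ[ℤ] ℤ) (x : Fin d → ℤ) :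
    realExt g (castVec x) = g x := by
  conv_rhs => rw [← (Pi.basisFun ℤ (Fin d)).sum_repr x, map_sum]
  simp only [realExt, map_smul, smul_eq_mul, Pi.basisFun_repr, Pi.basisFun_apply]
  simp [castVec, mul_comm]

lemma IsFanoPolyhedron.convexHull_extremePoints (hP : IsFanoPolyhedron P) :
    convexHull ℝ (P.extremePoints ℝ) = P := by
  obtain ⟨s, rfl⟩ := hP.polytope
  have hfin := s.finite_toSet.subset (extremePoints_convexHull_subset (𝕜 := ℝ)
    (A := (s : Set (Fin d → ℝ))))
  have h := closure_convexHull_extremePoints (s.finite_toSet.isCompact_convexHull ℝ)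
    (convex_convexHull ℝ _)
  rwa [(hfin.isClosed_convexHull ℝ).closure_eq] at h

lemma IsFanoPolyhedron.convex (hP : IsFanoPolyhedron P) : Convex ℝ P := by
  rw [← hP.convexHull_extremePoints]
  exact convex_convexHull ℝ _

lemma IsFanoPolyhedron.exists_vertexSet (hP : IsFanoPolyhedron P) :
    ∃ V : Finset (Fin d → ℤ), P.extremePoints ℝ = castVec '' V := by
  have hfin : (P.extremePoints ℝ).Finite := by
    obtain ⟨s, rfl⟩ := hP.polytope
    exact s.finite_toSet.subset extremePoints_convexHull_subset
  refine ⟨(hfin.preimage (castVec_injective.injOn)).toFinset, ?_⟩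
  rw [Set.Finite.coe_toFinset, Set.image_preimage_eq_of_subset]
  intro v hv
  obtain ⟨z, rfl⟩ := hP.lattice v hv
  exact ⟨z, rfl⟩

lemma IsFanoPolyhedron.exists_smul_mem (hP : IsFanoPolyhedron P) (x : Fin d → ℝ) :
    ∃ t : ℝ, 0 < t ∧ t • x ∈ P ∧ -(t • x) ∈ P := by
  have hP0 : P ∈ nhds (0 : Fin d → ℝ) := mem_interior_iff_mem_nhds.1 hP.zero_mem_interior
  have h1 : Filter.Tendsto (fun t : ℝ => t • x) (nhds 0) (nhds 0) := by
    have : Continuous fun t : ℝ => t • x := by fun_prop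
    simpa using this.tendsto 0
  have h2 : Filter.Tendsto (fun t : ℝ => -(t • x)) (nhds 0) (nhds 0) := by
    simpa using h1.neg
  have h3 := ((h1.eventually hP0).and (h2.eventually hP0)).filter_mono
    (nhdsWithin_le_nhds (s := Set.Ioi 0))
  obtain ⟨t, ht, ht0⟩ := (h3.and self_mem_nhdsWithin).exists
  exact ⟨t, ht0, ht⟩

lemma IsFanoPolyhedron.zero_mem (hP : IsFanoPolyhedron P) : (0 : Fin d → ℝ) ∈ P :=
  interior_subset hP.zero_mem_interior

lemma IsFanoPolyhedron.zero_notMem_extremePoints (hP : IsFanoPolyhedron P) (hd : 0 < d) :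
    (0 : Fin d → ℝ) ∉ P.extremePoints ℝ := by
  intro h0
  obtain ⟨t, ht, h1, h2⟩ := hP.exists_smul_mem (fun _ => 1)
  have h3 := (mem_extremePoints.1 h0).2 _ h1 _ h2
    ⟨1 / 2, 1 / 2, by norm_num, by norm_num, by norm_num, by simp⟩
  have h4 := congrFun h3.1 ⟨0, hd⟩
  simp at h4
  exact ht.ne' h4

lemma IsFanoPolyhedron.le_of_le_vertices (hP : IsFanoPolyhedron P)
    (hV : P.extremePoints ℝ = castVec '' V) {f : StrongDual ℝ (Fin d → ℝ)} {c : ℝ}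
    (hf : ∀ v ∈ V, f (castVec v) ≤ c) {x : Fin d → ℝ} (hx : x ∈ P) : f x ≤ c := by
  have h : convexHull ℝ (P.extremePoints ℝ) ⊆ {x | f x ≤ c} := by
    refine convexHull_min ?_ (convex_halfSpace_le f.toLinearMap.isLinear c)
    rw [hV]
    rintro _ ⟨v, hv, rfl⟩
    exact hf v hv
  rw [hP.convexHull_extremePoints] at h
  exact h hx

lemma IsFanoPolyhedron.eq_zero_of_nonpos (hP : IsFanoPolyhedron P)
    {f : StrongDual ℝ (Fin d → ℝ)} (hf : ∀ x ∈ P, f x ≤ 0) : f = 0 := by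
  ext1 x
  obtain ⟨t, ht, h1, h2⟩ := hP.exists_smul_mem x
  have h3 := hf _ h1
  have h4 := hf _ h2
  rw [map_neg, map_smul, smul_eq_mul] at h4
  rw [map_smul, smul_eq_mul] at h3
  have h5 : t * f x = 0 := by linarith
  simpa [ht.ne'] using h5

/-- The polar dual of the polytope with vertex set `V`. -/
def polarDual (V : Finset (Fin d → ℤ)) : Set (StrongDual ℝ (Fin d → ℝ)) :=
  {f | ∀ v ∈ V, f (castVec v) ≤ 1}

lemma IsFanoPolyhedron.isCompact_polarDual (hP : IsFanoPolyhedron P)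
    (hV : P.extremePoints ℝ = castVec '' V) : IsCompact (polarDual V) := by
  refine Metric.isCompact_of_isClosed_isBounded ?_ ?_
  · have : polarDual V = ⋂ v ∈ V, {f | f (castVec v) ≤ 1} := by
      ext f; simp [polarDual]
    rw [this]
    refine isClosed_biInter fun v _ => isClosed_le ?_ continuous_const
    exact (ContinuousLinearMap.apply ℝ ℝ (castVec v)).continuous
  · obtain ⟨r, hr, hball⟩ := Metric.nhds_basis_closedBall.mem_iff.1
      (mem_interior_iff_mem_nhds.1 hP.zero_mem_interior)
    rw [isBounded_iff_forall_norm_le]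
    refine ⟨1 / r, fun f hf => ContinuousLinearMap.opNorm_bound_of_ball_bound hr 1 f fun z hz => ?_⟩
    have h1 := hP.le_of_le_vertices hV hf (hball hz)
    have h2 := hP.le_of_le_vertices hV hf (hball (a := -z) (by simpa using hz))
    rw [map_neg] at h2
    rw [Real.norm_eq_abs, abs_le]
    constructor <;> linarith

/-- A linear form that is at most `1` on the vertices and takes the value `1` on a spanning set of
vertices cuts out a facet. -/
lemma IsFanoPolyhedron.exists_isFacetBasis_of_span (hP : IsFanoPolyhedron P) (hd : 0 < d)
    (hV : P.extremePoints ℝ = castVec '' V) {f : StrongDual ℝ (Fin d → ℝ)}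
    (hf : f ∈ polarDual V)
    (hspan : Submodule.span ℝ {x | ∃ v ∈ V, f (castVec v) = 1 ∧ castVec v = x} = ⊤) :
    ∃ b, IsFacetBasis V b ∧ (∀ x, (level b x : ℝ) = f (castVec x)) ∧
      IsFanGenerators P (Set.range fun i => castVec (b i)) := by
  have hle : ∀ x ∈ P, f x ≤ 1 := fun x hx => hP.le_of_le_vertices hV hf hx
  have hVP : ∀ v ∈ V, castVec v ∈ P := fun v hv =>
    extremePoints_subset (𝕜 := ℝ) (hV ▸ Set.mem_image_of_mem castVec hv)
  obtain ⟨v₀, hv₀, hfv₀⟩ : ∃ v ∈ V, f (castVec v) = 1 := by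
    by_contra! h
    have h1 : {x | ∃ v ∈ V, f (castVec v) = 1 ∧ castVec v = x} = ∅ := by
      ext x
      simp only [Set.mem_ofPred_eq, Set.mem_empty_iff_false, iff_false]
      rintro ⟨v, hv, h2, -⟩
      exact h v hv h2
    rw [h1, Submodule.span_empty] at hspan
    have h2 : (fun _ => 1 : Fin d → ℝ) ∈ (⊥ : Submodule ℝ (Fin d → ℝ)) := by
      rw [hspan]; trivial
    have h3 := congrFun ((Submodule.mem_bot ℝ).1 h2) ⟨0, hd⟩
    norm_num at h3
  set F : Set (Fin d → ℝ) := {x | x ∈ P ∧ f x = 1} with hF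
  have hexp : IsExposed ℝ P F := fun _ => ⟨f, by
    ext x
    refine and_congr_right fun hx => ⟨fun h y hy => (hle y hy).trans h.ge, fun h => ?_⟩
    exact le_antisymm (hle x hx) (hfv₀ ▸ h _ (hVP v₀ hv₀))⟩
  have hv₀F : castVec v₀ ∈ F := ⟨hVP v₀ hv₀, hfv₀⟩
  have hproper : IsProperFace P F := by
    refine ⟨hexp, ⟨_, hv₀F⟩, fun h => ?_⟩
    have h1 := hP.zero_mem
    rw [← h] at h1
    have := h1.2
    simp at this
  -- The direction space of `F` lies in the kernel of `f`, and together with one vertex of `F` it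
  -- spans the whole space.
  have hfin : finrank ℝ (vectorSpan ℝ F) + 1 = d := by
    have hne : f.toLinearMap ≠ 0 := fun h => by
      have : f (castVec v₀) = 0 := LinearMap.congr_fun h _
      rw [hfv₀] at this
      norm_num at this
    have h1 := Module.Dual.finrank_ker_add_one_of_ne_zero hne
    rw [finrank_fin_fun] at h1
    have h2 : vectorSpan ℝ F ≤ LinearMap.ker f.toLinearMap := by
      rw [vectorSpan_def, Submodule.span_le]
      rintro _ ⟨x, hx, y, hy, rfl⟩
      simp [hx.2, hy.2]
    have h3 : (⊤ : Submodule ℝ (Fin d → ℝ)) ≤ vectorSpan ℝ F ⊔ Submodule.span ℝ {castVec v₀} := by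
      rw [← hspan, Submodule.span_le]
      rintro _ ⟨v, hv, hfv, rfl⟩
      have h4 : castVec v - castVec v₀ ∈ vectorSpan ℝ F :=
        vsub_mem_vectorSpan ℝ (show castVec v ∈ F from ⟨hVP v hv, hfv⟩) hv₀F
      have h5 := Submodule.add_mem_sup h4 (Submodule.mem_span_singleton_self (R := ℝ) (castVec v₀))
      simpa using h5
    have h4 := Submodule.finrank_mono h2
    have h5 := Submodule.finrank_mono h3
    have h6 := Submodule.finrank_add_le_finrank_add_finrank (vectorSpan ℝ F)
      (Submodule.span ℝ {castVec v₀})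
    have h7 := finrank_span_singleton (K := ℝ) (v := castVec v₀) (fun h => by
      rw [h, map_zero] at hfv₀
      norm_num at hfv₀)
    rw [finrank_top, finrank_fin_fun] at h5
    omega
  obtain ⟨A, hA, hdet⟩ := hP.unimodular F ⟨hproper, hfin⟩
  have hunit : IsUnit ((Pi.basisFun ℤ (Fin d)).det A) := by
    exact (Pi.basisFun_det_apply (A : Fin d → Fin d → ℤ)).symm ▸ Int.isUnit_iff.2 hdet
  obtain ⟨hli, hsp⟩ := (Basis.is_basis_iff_det _).2 hunit
  have hmem : ∀ v, (v ∈ V ∧ f (castVec v) = 1) ↔ ∃ i, A i = v := fun v => by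
    have h1 : castVec v ∈ F.extremePoints ℝ ↔ ∃ i, A i = v := by
      rw [hA]
      exact exists_congr fun i => castVec_injective.eq_iff (a := A i) (b := v)
    rw [← h1, hexp.isExtreme.extremePoints_eq, hV, Set.mem_inter_iff,
      castVec_injective.mem_set_image]
    exact ⟨fun h => ⟨⟨hVP v h.1, h.2⟩, h.1⟩, fun h => ⟨h.2, h.1.2⟩⟩
  have hb : ∀ i, Basis.mk hli hsp.ge i = A i := fun i => Basis.mk_apply _ _ i
  have hlev : ∀ x, (level (Basis.mk hli hsp.ge) x : ℝ) = f (castVec x) := fun x => by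
    rw [castVec_eq_sum (Basis.mk hli hsp.ge) x, map_sum, level, Int.cast_sum]
    refine Finset.sum_congr rfl fun i _ => ?_
    rw [map_smul, hb, ((hmem _).2 ⟨i, rfl⟩).2, smul_eq_mul, mul_one]
  refine ⟨Basis.mk hli hsp.ge, ⟨fun i => ?_, fun x hx => ?_, fun x hx h => ?_⟩, hlev,
    Or.inr ⟨F, hproper, ?_⟩⟩
  · rw [hb]
    exact ((hmem _).2 ⟨i, rfl⟩).1
  · have := hf x hx
    rw [← hlev x] at this
    exact_mod_cast this
  · obtain ⟨i, hi⟩ := (hmem x).1 ⟨hx, by rw [← hlev x, h, Int.cast_one]⟩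
    exact ⟨i, by rw [hb, hi]⟩
  · simp only [hb, hA]
    rfl

lemma eventually_add_smul_mem_polarDual {f g : StrongDual ℝ (Fin d → ℝ)} (hf : f ∈ polarDual V)
    (hg : ∀ v ∈ V, f (castVec v) = 1 → g (castVec v) ≤ 0) :
    ∀ᶠ ε : ℝ in nhdsWithin 0 (Set.Ioi 0), f + ε • g ∈ polarDual V := by
  have h : ∀ v ∈ V, ∀ᶠ ε : ℝ in nhdsWithin 0 (Set.Ioi 0), (f + ε • g) (castVec v) ≤ 1 := by
    intro v hv
    rcases (hf v hv).eq_or_lt with h1 | h1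
    · filter_upwards [self_mem_nhdsWithin] with ε hε
      have h2 := mul_nonpos_of_nonneg_of_nonpos (le_of_lt hε) (hg v hv h1)
      simp only [add_apply, smul_apply, smul_eq_mul, h1]
      linarith
    · have hc : Continuous fun ε : ℝ => (f + ε • g) (castVec v) := by
        simp only [add_apply, smul_apply, smul_eq_mul]
        fun_prop
      have h2 : (f + (0 : ℝ) • g) (castVec v) < 1 := by simpa using h1
      exact ((hc.tendsto 0).eventually_lt_const h2).filter_mono nhdsWithin_le_nhds |>.mono
        fun _ h => h.le
  filter_upwards [(Filter.eventually_all_finset V).2 h] with ε hε using hε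

/-- Every linear form on the polar dual that is given by a lattice point `y` is maximal at the linear
form of a facet, and `y` lies in the cone over this facet. -/
lemma IsFanoPolyhedron.exists_maximal_facet (hP : IsFanoPolyhedron P) (hd : 0 < d)
    (hV : P.extremePoints ℝ = castVec '' V) (y : Fin d → ℤ) :
    ∃ b, IsFacetBasis V b ∧ (∀ i, 0 ≤ b.repr y i) ∧
      (∀ f ∈ polarDual V, f (castVec y) ≤ level b y) ∧
      IsFanGenerators P (Set.range fun i => castVec (b i)) := by
  have hQ := hP.isCompact_polarDual hV
  set ev : StrongDual ℝ (StrongDual ℝ (Fin d → ℝ)) := ContinuousLinearMap.apply ℝ ℝ (castVec y)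
    with hev
  have hE : IsExposed ℝ (polarDual V) (ev.toExposed (polarDual V)) :=
    ContinuousLinearMap.toExposed.isExposed
  obtain ⟨m, hm, hmax⟩ := hQ.exists_isMaxOn ⟨0, fun v _ => by simp⟩ ev.continuous.continuousOn
  -- A maximizer alone need not correspond to a facet; an extreme point of the face of maximizers is
  -- also extreme in the polar dual.
  obtain ⟨u, hu⟩ := (hE.isCompact hQ).extremePoints_nonempty ⟨m, hm, fun z hz => hmax hz⟩
  have hu1 : u ∈ ev.toExposed (polarDual V) := extremePoints_subset hu
  have hu2 : u ∈ (polarDual V).extremePoints ℝ := hE.isExtreme.extremePoints_subset_extremePoints hu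
  have hspan : Submodule.span ℝ {x | ∃ v ∈ V, u (castVec v) = 1 ∧ castVec v = x} = ⊤ := by
    by_contra hne
    -- A nonzero form vanishing on all tight vertices could be added to `u` in both directions,
    -- against extremality.
    obtain ⟨g, hg0, hg⟩ := Submodule.exists_le_ker_of_lt_top _ (lt_top_iff_ne_top.2 hne)
    set g' : StrongDual ℝ (Fin d → ℝ) := LinearMap.toContinuousLinearMap g with hg'
    have hgv : ∀ v ∈ V, u (castVec v) = 1 → g' (castVec v) = 0 := fun v hv h =>
      hg (Submodule.subset_span ⟨v, hv, h, rfl⟩)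
    have h1 := eventually_add_smul_mem_polarDual hu1.1 (g := g') fun v hv h => (hgv v hv h).le
    have h2 := eventually_add_smul_mem_polarDual hu1.1 (g := -g') fun v hv h => by
      simp [hgv v hv h]
    obtain ⟨ε, ⟨h3, h4⟩, hε⟩ := ((h1.and h2).and self_mem_nhdsWithin).exists
    have h5 := (mem_extremePoints.1 hu2).2 _ h3 _ h4
      ⟨1 / 2, 1 / 2, by norm_num, by norm_num, by norm_num, by module⟩
    have h6 : ε • g' = 0 := by simpa using h5.1
    rcases smul_eq_zero.1 h6 with h | h
    · exact (ne_of_gt hε) h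
    · exact hg0 (by simpa [hg'] using h)
  obtain ⟨b, hb, hlev, hgen⟩ := hP.exists_isFacetBasis_of_span hd hV hu1.1 hspan
  refine ⟨b, hb, fun i => ?_, fun f hf => ?_, hgen⟩
  · by_contra! hi
    -- Subtracting a small multiple of the i-th coordinate form stays in the polar dual; if `y` had
    -- a negative i-th coordinate, this would increase the maximum.
    have h1 := eventually_add_smul_mem_polarDual hu1.1 (g := -realExt (b.coord i))
      fun v hv h => by
        rw [← hlev v] at h
        obtain ⟨j, rfl⟩ := hb.mem_range v hv (by exact_mod_cast h)
        rw [neg_apply, realExt_castVec]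
        simp only [Basis.coord_apply, Basis.repr_self, Finsupp.single_apply]
        split_ifs <;> simp
    obtain ⟨ε, h2, hε⟩ := (h1.and self_mem_nhdsWithin).exists
    have h3 := hu1.2 _ h2
    simp only [hev, ContinuousLinearMap.apply_apply, add_apply,
      smul_apply, neg_apply, realExt_castVec,
      Basis.coord_apply, smul_eq_mul] at h3
    have h4 : (b.repr y i : ℝ) < 0 := by exact_mod_cast hi
    have h5 : (0 : ℝ) < ε := hε
    nlinarith
  · rw [hlev y]
    exact hu1.2 f hf

lemma IsFanoPolyhedron.exists_neighbor (hP : IsFanoPolyhedron P) (hd : 0 < d)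
    (hV : P.extremePoints ℝ = castVec '' V) {b : Basis (Fin d) ℤ (Fin d → ℤ)}
    (hb : IsFacetBasis V b) (i : Fin d) : ∃ b', IsFacetBasis V b' ∧
      (∀ j, j ≠ i → b' j = b j) ∧ b' i ≠ b i := by
  classical
  have hne : (V.filter fun v => b.repr v i < 0).Nonempty := by
    by_contra h
    rw [Finset.not_nonempty_iff_eq_empty, Finset.filter_eq_empty_iff] at h
    have h1 : -realExt (b.coord i) = 0 := hP.eq_zero_of_nonpos fun x hx =>
      hP.le_of_le_vertices hV (fun v hv => by
        rw [neg_apply, realExt_castVec, Basis.coord_apply]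
        have := h hv
        rw [not_lt] at this
        simpa using this) hx
    have h2 := congrArg (fun f => f (castVec (b i))) h1
    simp [realExt_castVec] at h2
  -- Ratio test: the facet form is tilted about the ridge opposite to `b i`, and `w` is a first
  -- vertex that it meets. The minimal ratio `T` keeps the tilted form in the polar dual.
  obtain ⟨w, hw, hmin⟩ := Finset.exists_min_image _
    (fun v => (1 - level b v : ℝ) / -(b.repr v i : ℝ)) hne
  obtain ⟨hwV, hwi⟩ := Finset.mem_filter.1 hw
  have hwi' : (0 : ℝ) < -(b.repr w i : ℝ) := by
    have : (b.repr w i : ℝ) < 0 := by exact_mod_cast hwi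
    linarith
  set T : ℝ := (1 - level b w : ℝ) / -(b.repr w i : ℝ) with hT
  have hle : ∀ v ∈ V, (level b v : ℝ) ≤ 1 := fun v hv => by exact_mod_cast hb.level_le v hv
  have hT0 : 0 ≤ T := div_nonneg (by linarith [hle w hwV]) hwi'.le
  set f : StrongDual ℝ (Fin d → ℝ) := realExt (∑ j, b.coord j) - T • realExt (b.coord i) with hf
  have hfx : ∀ x, f (castVec x) = level b x - T * b.repr x i := fun x => by
    simp [hf, realExt_castVec, level]
  have hfw : f (castVec w) = 1 := by
    rw [hfx]
    have : T * -(b.repr w i : ℝ) = 1 - level b w := div_mul_cancel₀ _ hwi'.ne'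
    linarith
  have hfb : ∀ j, j ≠ i → f (castVec (b j)) = 1 := fun j hj => by
    rw [hfx, level_self]
    simp [hj]
  have hfQ : f ∈ polarDual V := fun v hv => by
    rw [hfx]
    by_cases h : b.repr v i < 0
    · have h1 := hmin v (Finset.mem_filter.2 ⟨hv, h⟩)
      have h2 : (0 : ℝ) < -(b.repr v i : ℝ) := by
        have : (b.repr v i : ℝ) < 0 := by exact_mod_cast h
        linarith
      rw [le_div_iff₀ h2] at h1
      linarith
    · have h1 : (0 : ℝ) ≤ b.repr v i := by exact_mod_cast not_lt.1 h
      have := mul_nonneg hT0 h1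
      linarith [hle v hv]
  have hspan : Submodule.span ℝ {x | ∃ v ∈ V, f (castVec v) = 1 ∧ castVec v = x} = ⊤ := by
    set S := Submodule.span ℝ {x | ∃ v ∈ V, f (castVec v) = 1 ∧ castVec v = x} with hS
    have h1 : ∀ j, j ≠ i → castVec (b j) ∈ S := fun j hj =>
      Submodule.subset_span ⟨b j, hb.mem j, hfb j hj, rfl⟩
    have h2 : castVec (b i) ∈ S := by
      have h3 : castVec w ∈ S := Submodule.subset_span ⟨w, hwV, hfw, rfl⟩
      rw [castVec_eq_sum b w, ← Finset.add_sum_erase _ _ (Finset.mem_univ i)] at h3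
      have h4 : ∑ j ∈ Finset.univ.erase i, (b.repr w j : ℝ) • castVec (b j) ∈ S :=
        Submodule.sum_mem _ fun j hj => S.smul_mem _ (h1 j (Finset.ne_of_mem_erase hj))
      have h5 := (Submodule.add_mem_iff_left S h4).1 h3
      exact (Submodule.smul_mem_iff S (neg_pos.1 hwi').ne).1 h5
    have h3 : ∀ x, castVec x ∈ S := fun x => by
      rw [castVec_eq_sum b x]
      refine Submodule.sum_mem _ fun j _ => S.smul_mem _ ?_
      by_cases hj : j = i
      · exact hj ▸ h2
      · exact h1 j hj
    rw [eq_top_iff, ← (Pi.basisFun ℝ (Fin d)).span_eq, Submodule.span_le]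
    rintro _ ⟨k, rfl⟩
    have h4 : (Pi.basisFun ℝ (Fin d)) k = castVec (Pi.single k 1) := by
      ext l
      simp only [Pi.basisFun_apply, castVec, Pi.single_apply]
      split_ifs <;> simp
    rw [h4]
    exact h3 _
  obtain ⟨c, hc, hlev, -⟩ := hP.exists_isFacetBasis_of_span hd hV hfQ hspan
  have hrange : ∀ j, ∃ k, c k = if j = i then w else b j := fun j => by
    by_cases hj : j = i
    · rw [if_pos hj]
      exact hc.mem_range w hwV (by exact_mod_cast (hlev w).trans hfw)
    · rw [if_neg hj]
      exact hc.mem_range _ (hb.mem j) (by exact_mod_cast (hlev (b j)).trans (hfb j hj))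
  -- The facet found for the tilted form comes with an arbitrary numbering; `τ` matches it to that
  -- of `b`.
  choose τ hτ using hrange
  have hwb : ∀ j, w ≠ b j := fun j h => by
    rw [h] at hwi
    simp only [Basis.repr_self, Finsupp.single_apply] at hwi
    split_ifs at hwi <;> omega
  have hinj : Function.Injective τ := fun j k hjk => by
    have h1 := (hτ j).symm.trans ((congrArg c hjk).trans (hτ k))
    by_cases hj : j = i <;> by_cases hk : k = i
    · rw [hj, hk]
    · rw [if_pos hj, if_neg hk] at h1
      exact absurd h1 (hwb k)
    · rw [if_neg hj, if_pos hk] at h1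
      exact absurd h1.symm (hwb j)
    · rw [if_neg hj, if_neg hk] at h1
      exact b.injective h1
  refine ⟨c.reindex (Equiv.ofBijective τ (Finite.injective_iff_bijective.1 hinj)).symm,
    hc.reindex _, fun j hj => ?_, ?_⟩
  · simp [hτ, hj]
  · simpa [hτ] using hwb i

lemma exists_smul_of_mem_hull {F : Set (Fin d → ℝ)} (hF : Convex ℝ F) {x : Fin d → ℝ}
    (hx : x ∈ PointedCone.hull ℝ F) : x = 0 ∨ ∃ t : ℝ, 0 < t ∧ ∃ p ∈ F, x = t • p := by
  induction hx using Submodule.span_induction with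
  | mem p hp => exact Or.inr ⟨1, one_pos, p, hp, (one_smul ℝ p).symm⟩
  | zero => exact Or.inl rfl
  | add x y _ _ hx hy =>
    rcases hx with rfl | ⟨t, ht, p, hp, rfl⟩
    · simpa using hy
    rcases hy with rfl | ⟨s, hs, q, hq, rfl⟩
    · exact Or.inr ⟨t, ht, p, hp, by simp⟩
    refine Or.inr ⟨t + s, add_pos ht hs, (t / (t + s)) • p + (s / (t + s)) • q,
      hF hp hq (by positivity) (by positivity) (by field_simp), ?_⟩
    rw [smul_add, smul_smul, smul_smul, mul_div_cancel₀ _ (add_pos ht hs).ne',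
      mul_div_cancel₀ _ (add_pos ht hs).ne']
  | smul a x _ hx =>
    rcases hx with rfl | ⟨t, ht, p, hp, rfl⟩
    · exact Or.inl (smul_zero _)
    rcases eq_or_lt_of_le a.2 with ha | ha
    · refine Or.inl ?_
      have : a = 0 := Subtype.ext ha.symm
      rw [this, zero_smul]
    · exact Or.inr ⟨a * t, mul_pos ha ht, p, hp, by rw [mul_smul]; rfl⟩

/-- Two vertices in a common cone of the fan lie in a common proper face. -/
lemma IsFanoPolyhedron.exists_mem_polarDual (hP : IsFanoPolyhedron P) (hd : 0 < d)
    (hV : P.extremePoints ℝ = castVec '' V) {σ : PointedCone ℝ (Fin d → ℝ)}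
    (hσ : σ ∈ polyhedralFan P) : ∃ f ∈ polarDual V, ∀ x ∈ V, castVec x ∈ σ →
      f (castVec x) = 1 := by
  have h0 := hP.zero_notMem_extremePoints hd
  have hVe : ∀ v ∈ V, castVec v ∈ P.extremePoints ℝ := fun v hv =>
    hV ▸ Set.mem_image_of_mem castVec hv
  obtain ⟨G, rfl | ⟨F, ⟨hF, ⟨p, hp⟩, hFP⟩, rfl⟩, rfl⟩ := hσ
  · refine ⟨0, fun v _ => by simp, fun x hx hxσ => ?_⟩
    have h1 : castVec x = 0 := by
      have h2 : PointedCone.hull ℝ (∅ : Set (Fin d → ℝ)) = ⊥ := Submodule.span_empty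
      rw [h2] at hxσ
      exact hxσ
    exact absurd (h1 ▸ hVe x hx) h0
  obtain ⟨l, hl⟩ := hF ⟨p, hp⟩
  have hmax : ∀ q ∈ F, ∀ x ∈ P, l x ≤ l q := fun q hq => by
    rw [hl] at hq
    exact hq.2
  have hFsub := hF.subset
  have hc : 0 < l p := by
    by_contra! h
    have h1 : l = 0 := hP.eq_zero_of_nonpos fun x hx => (hmax p hp x hx).trans h
    exact hFP (by rw [hl, h1]; simp)
  have hlp : ∀ q ∈ F, l q = l p := fun q hq =>
    le_antisymm (hmax p hp q (hFsub hq)) (hmax q hq p (hFsub hp))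
  refine ⟨(l p)⁻¹ • l, fun v hv => ?_, fun x hx hxσ => ?_⟩
  · rw [smul_apply, smul_eq_mul, inv_mul_le_one₀ hc]
    exact hmax p hp _ (hVe v hv).1
  · have hxF : castVec x ∈ PointedCone.hull ℝ F := Submodule.span_mono extremePoints_subset hxσ
    rcases exists_smul_of_mem_hull (hF.convex hP.convex) hxF with h | ⟨t, ht, q, hq, h⟩
    · exact absurd (h ▸ hVe x hx) h0
    have hlx : l (castVec x) = t * l p := by rw [h, map_smul, smul_eq_mul, hlp q hq]
    have ht1 : t ≤ 1 := by
      have := hmax p hp _ (hVe x hx).1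
      rw [hlx] at this
      exact le_of_mul_le_mul_right (by linarith) hc
    rcases ht1.eq_or_lt with rfl | ht1
    · rw [smul_apply, smul_eq_mul, hlx, one_mul, inv_mul_cancel₀ hc.ne']
    · have h1 := ((mem_extremePoints.1 (hVe x hx)).2 0 hP.zero_mem q (hFsub hq)
        ⟨1 - t, t, by linarith, ht, by ring, by rw [h]; simp⟩).1
      exact absurd (h1 ▸ hVe x hx) h0

/-- The vertex set of a Fano polyhedron all of whose two-element primitive relations have the form
`v + v' = 0`. -/
lemma IsFanoPolyhedron.isNeighborlyFano (hP : IsFanoPolyhedron P) (hd : 0 < d)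
    (hV : P.extremePoints ℝ = castVec '' V)
    (hprim : ∀ S : Finset (Fin d → ℝ), S.card = 2 → IsPrimitiveCollection P S →
      IsPrimitiveRelation P S 0) : IsNeighborlyFano V := by
  classical
  refine ⟨fun y => ?_, fun b hb i => hP.exists_neighbor hd hV hb i, fun x hx y hy hxy h0 => ?_⟩
  · obtain ⟨b, hb, hy, -, -⟩ := hP.exists_maximal_facet hd hV y
    exact ⟨b, hb, hy⟩
  have hne : castVec x ≠ castVec y := fun h => hxy (castVec_injective h)
  have hcone : ∀ v : Fin d → ℤ, ∃ σ ∈ polyhedralFan P, castVec v ∈ σ := fun v => by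
    obtain ⟨b, hb, hv, -, hgen⟩ := hP.exists_maximal_facet hd hV v
    refine ⟨_, ⟨_, hgen, rfl⟩, ?_⟩
    rw [castVec_eq_sum b v]
    refine Submodule.sum_mem _ fun i _ => ?_
    have h1 : (0 : ℝ) ≤ b.repr v i := by exact_mod_cast hv i
    exact Submodule.smul_mem _ (⟨b.repr v i, h1⟩ : {c : ℝ // 0 ≤ c})
      (Submodule.subset_span ⟨i, rfl⟩)
  obtain ⟨σ, hσ, hxσ, hyσ⟩ : ∃ σ ∈ polyhedralFan P, castVec x ∈ σ ∧ castVec y ∈ σ := by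
    by_contra! hno
    have hcol : IsPrimitiveCollection P {castVec x, castVec y} := by
      refine ⟨?_, ?_, fun T hT => ?_⟩
      · rw [hV, Finset.coe_pair, Set.insert_subset_iff, Set.singleton_subset_iff]
        exact ⟨Set.mem_image_of_mem _ hx, Set.mem_image_of_mem _ hy⟩
      · rintro ⟨σ, hσ, h⟩
        exact hno σ hσ (h (by simp)) (h (by simp))
      · have hsub := hT.subset
        by_cases hxT : castVec x ∈ T
        · obtain ⟨σ, hσ, hxσ⟩ := hcone x
          refine ⟨σ, hσ, fun t ht => ?_⟩
          rcases Finset.mem_insert.1 (hsub ht) with rfl | h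
          · exact hxσ
          · rw [Finset.mem_singleton] at h
            subst h
            exact absurd (Finset.insert_subset_iff.2 ⟨hxT, Finset.singleton_subset_iff.2 ht⟩) hT.2
        · obtain ⟨σ, hσ, hyσ⟩ := hcone y
          refine ⟨σ, hσ, fun t ht => ?_⟩
          rcases Finset.mem_insert.1 (hsub ht) with rfl | h
          · exact absurd ht hxT
          · rw [Finset.mem_singleton] at h
            exact h ▸ hyσ
    have hrel := (hprim _ (Finset.card_pair hne) hcol).relation
    rw [Finset.sum_pair hne, ← castVec_add] at hrel
    refine h0 (castVec_injective ?_)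
    rw [hrel, castVec_zero]
    simp
  obtain ⟨f, hf, hf1⟩ := hP.exists_mem_polarDual hd hV hσ
  -- The form `f` takes the value 2 at `x + y`, so the maximizing facet form does at least as well;
  -- being at most 1 on each vertex, it is 1 on both.
  obtain ⟨b, hb, -, hmax, -⟩ := hP.exists_maximal_facet hd hV (x + y)
  have h1 := hmax f hf
  rw [castVec_add, map_add, hf1 x hx hxσ, hf1 y hy hyσ, level_add] at h1
  have h2 : 2 ≤ level b x + level b y := by
    have : ((2 : ℤ) : ℝ) ≤ ((level b x + level b y : ℤ) : ℝ) := by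
      push_cast
      push_cast at h1
      linarith
    exact_mod_cast this
  have h3 := hb.level_le x hx
  have h4 := hb.level_le y hy
  exact ⟨b, hb, hb.mem_range x hx (by omega), hb.mem_range y hy (by omega)⟩

end Geometry

/-! ### Lattice isomorphism given by coordinates in a basis -/

section Isomorphism

variable {d : ℕ} {P : Set (Fin d → ℝ)} {V : Finset (Fin d → ℤ)}

lemma castVec_repr_self (g : Basis (Fin d) ℤ (Fin d → ℤ)) (i : Fin d) :
    castVec (g.equivFun (g i)) = stdVec i := by
  ext j
  simp only [castVec, stdVec, Basis.equivFun_self, Pi.single_apply, eq_comm]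
  split_ifs <;> simp

lemma IsFanoPolyhedron.isIsomorphicTo_convexHull (hP : IsFanoPolyhedron P)
    (hV : P.extremePoints ℝ = castVec '' V) (g : Basis (Fin d) ℤ (Fin d → ℤ)) :
    IsIsomorphicTo P (convexHull ℝ ((fun x => castVec (g.equivFun x)) '' (V : Set (Fin d → ℤ)))) := by
  set e : (Fin d → ℤ) ≃ₗ[ℤ] (Fin d → ℤ) := g.equivFun with he
  refine ⟨⟨LinearMap.toMatrix' e.toLinearMap, LinearMap.toMatrix' e.symm.toLinearMap, ?_, ?_⟩, ?_⟩
  · rw [← LinearMap.toMatrix'_comp]; simp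
  · rw [← LinearMap.toMatrix'_comp]; simp
  · have h1 : ∀ x, Matrix.mulVec ((LinearMap.toMatrix' e.toLinearMap).map fun z : ℤ => (z : ℝ))
        (castVec x) = castVec (e x) := fun x => by
      have h2 : e x = Matrix.mulVec (LinearMap.toMatrix' e.toLinearMap) x := by
        rw [LinearMap.toMatrix'_mulVec]; rfl
      rw [h2]
      ext i
      simp [castVec, Matrix.mulVec, dotProduct]
    have h3 := (Matrix.mulVecLin ((LinearMap.toMatrix' e.toLinearMap).map
      fun z : ℤ => (z : ℝ))).image_convexHull (P.extremePoints ℝ)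
    rw [hP.convexHull_extremePoints, hV, Set.image_image] at h3
    refine h3.trans (congrArg _ (Set.image_congr fun x _ => h1 x))

lemma encard_extremePoints (hV : P.extremePoints ℝ = castVec '' V) :
    (P.extremePoints ℝ).encard = V.card := by
  rw [hV, castVec_injective.encard_image, Set.encard_coe_eq_coe_finsetCard]

end Isomorphism

theorem mainTheorem11 (P : Set (Fin 4 → ℝ)) (hP : IsFanoPolyhedron P)
    (hprim : ∀ S : Finset (Fin 4 → ℝ), S.card = 2 → IsPrimitiveCollection P S →
      IsPrimitiveRelation P S 0) :
    (P.extremePoints ℝ).encard ≤ 10 ∧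
    ((P.extremePoints ℝ).encard = 10 →
      IsIsomorphicTo P (convexHull ℝ
        (Set.range (fun i : Fin 4 => stdVec i) ∪ Set.range (fun i : Fin 4 => -stdVec i) ∪
          {∑ i : Fin 4, stdVec i, -∑ i : Fin 4, stdVec i}))) ∧
    ((P.extremePoints ℝ).encard = 9 →
      IsIsomorphicTo P (convexHull ℝ
        (Set.range (fun i : Fin 4 => stdVec i) ∪ Set.range (fun i : Fin 4 => -stdVec i) ∪
          {∑ i : Fin 4, stdVec i}))) := by
  obtain ⟨V, hV⟩ := hP.exists_vertexSet
  have hN := hP.isNeighborlyFano (by norm_num) hV hprim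
  rw [encard_extremePoints hV]
  refine ⟨by exact_mod_cast hN.card_le, fun hc => ?_, fun hc => ?_⟩
  · obtain ⟨g, hg⟩ := hN.classification_ten (by exact_mod_cast hc)
    convert hP.isIsomorphicTo_convexHull hV g using 2
    have hV' : (V : Set (Fin 4 → ℤ)) = Set.range g ∪ Set.range (fun i => -g i) ∪
        {∑ i, g i, -∑ i, g i} := by
      ext x
      simp only [Finset.mem_coe, hg x, exists_or, Set.mem_union, Set.mem_range, Set.mem_insert_iff,
        Set.mem_singleton_iff, eq_comm (a := x)]
    rw [hV', Set.image_union, Set.image_union, Set.image_pair, ← Set.range_comp, ← Set.range_comp]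
    simp only [Function.comp_def, map_neg, map_sum, castVec_neg, castVec_sum, castVec_repr_self]
  · obtain ⟨g, hg⟩ := hN.classification_nine (by exact_mod_cast hc)
    convert hP.isIsomorphicTo_convexHull hV g using 2
    have hV' : (V : Set (Fin 4 → ℤ)) = Set.range g ∪ Set.range (fun i => -g i) ∪
        {∑ i, g i} := by
      ext x
      simp only [Finset.mem_coe, hg x, exists_or, Set.mem_union, Set.mem_range,
        Set.mem_singleton_iff, eq_comm (a := x)]
    rw [hV', Set.image_union, Set.image_union, Set.image_singleton, ← Set.range_comp,
      ← Set.range_comp]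
    simp only [Function.comp_def, map_neg, map_sum, castVec_neg, castVec_sum, castVec_repr_self]
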